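/- Let $X\subset\mathbb R^{m}$ and $Y\subset\mathbb R^{n}$ be nonempty compact convex sets with diameters $D_X$, $D_Y$, and let $L$ be a real function that is continuously differentiable on an open set containing $X\times Y$. Assume that, for constants $L_{xx},L_{yy}\ge 0$, $L_{yx}>0$ and all $(x,y),(x',y')\in X\times Y$, $$\|\nabla_xL(x,y)-\nabla_xL(x',y')\|\le L_{xx}\|x-x'\|+L_{yx}\|y-y'\|,\qquad \|\nabla_yL(x,y)-\nabla_yL(x',y')\|\le L_{yx}\|x-x'\|+L_{yy}\|y-y'\|,$$ that $L(\cdot,y)$ is convex on $X$ for every $y\in Y$, and that, for some $\mu\ge 0$, $L(x,\cdot)$ is $\mu$-strongly concave on $Y$ (concave if $\mu=0$) for every $x\in X$. Write $f(x)=\max_{u\in Y}L(x,u)$ and $G_Y(x,y)=\max_{u\in Y}L(x,u)-L(x,y)$. For $\alpha>0$, call $Y$ $\alpha$-strongly convex if $\xi y+(1-\xi)y'+\xi(1-\xi)\frac{\alpha}{2}\|y-y'\|^2z\in Y$ for all $y,y'\in Y$, $\xi\in[0,1]$ and $\|z\|=1$. Let $x_0\in X$, $y_0\in Y$, $\tau_t=\frac1{t+1}$,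 $\beta_t\ge 0$, and $L_\beta(x,y)=L(x,y)-\frac{\beta}{2}\|y-y_0\|^2$. The LMO-LMO algorithm produces, for $t=0,1,2,\dots$, with arbitrary choices of the minimizers, $$v_t\in\operatorname*{argmin}_{v\in X}\nabla_xL(x_t,y_t)^\top v,\qquad x_{t+1}=x_t+\tau_t(v_t-x_t),$$ $$u_t\in\operatorname*{argmin}_{u\in Y}-\nabla_yL_{\beta_t}(x_t,y_t)^\top u,\qquad y_{t+1}=y_t+\gamma_t(u_t-y_t),\qquad \gamma_t=\min\Big\{\frac{\nabla_yL_{\beta_t}(x_t,y_t)^\top(u_t-y_t)}{(L_{yy}+\beta_t)\|u_t-y_t\|^2},\,1\Big\}$$ (with $y_{t+1}=y_t$ if $u_t=y_t$). Then the following hold for all $T\ge 1$, with a constant $K>0$ that depends only on $L_{xx},L_{yx},L_{yy},\mu,D_X,D_Y$, in (i) and (iii) also on $C$, and in (iii) and (iv) also on $\alpha$. (i) If $\beta_t=C(t+1)^{-1/5}$ with $C>0$, then $f(x_T)-\min_Xf\le K\,T^{-1/5}$ and $G_Y(x_T,y_T)\le K\,T^{-1/5}$. (ii) If $\mu>0$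 and $\beta_t=0$ for all $t$, then $f(x_T)-\min_Xf\le K\sqrt{\log(T+2)}\;T^{-1/3}$ and $G_Y(x_T,y_T)\le K\,T^{-2/3}$. (iii) If $Y$ is $\alpha$-strongly convex for some $\alpha>0$ and $\beta_t=C(t+1)^{-1/4}$ with $C>0$, then $f(x_T)-\min_Xf\le K\,T^{-1/4}$ and $G_Y(x_T,y_T)\le K\,T^{-1/4}$. (iv) If $\mu>0$, $Y$ is $\alpha$-strongly convex for some $\alpha>0$, and $\beta_t=0$ for all $t$, then $f(x_T)-\min_Xf\le K\sqrt{\log(T+2)}\;T^{-1/2}$ and $G_Y(x_T,y_T)\le K\,T^{-1}$. -/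

import Mathlib

namespace MinimaxLMO

noncomputable section

/-- `ℝⁿ` with the Euclidean norm. -/
abbrev Euc (n : ℕ) : Type := EuclideanSpace ℝ (Fin n)

/-- Partial gradient `∇ₓ L(x, y)` of the payoff function. -/
def gradX {m n : ℕ} (L : Euc m → Euc n → ℝ) (x : Euc m) (y : Euc n) : Euc m :=
  gradient (fun x' => L x' y) x

/-- Partial gradient `∇_y L(x, y)` of the payoff function. -/
def gradY {m n : ℕ} (L : Euc m → Euc n → ℝ) (x : Euc m) (y : Euc n) : Euc n :=
  gradient (fun y' => L x y') y

/-- The regularized payoff `L_β(x, y) = L(x, y) - (β / 2) ‖y - y₀‖²` with reference point `y₀`. -/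
def regPayoff {m n : ℕ} (L : Euc m → Euc n → ℝ) (y₀ : Euc n) (β : ℝ) :
    Euc m → Euc n → ℝ :=
  fun x y => L x y - β / 2 * ‖y - y₀‖ ^ 2

/-- The standing assumptions on the problem data: compact convex feasible sets with the given
diameters, `μ`-strong concavity in `y` with `μ ≥ 0` (for `μ = 0` this is concavity), `L`
continuously differentiable on an open set containing `X × Y`, Lipschitz partial gradients. -/
structure Smooth {m n : ℕ} (X : Set (Euc m)) (Y : Set (Euc n)) (L : Euc m → Euc n → ℝ)
    (Lxx Lyx Lyy μ DX DY : ℝ) : Prop where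
  compact_X : IsCompact X
  convex_X : Convex ℝ X
  diam_X : Metric.diam X = DX
  compact_Y : IsCompact Y
  convex_Y : Convex ℝ Y
  diam_Y : Metric.diam Y = DY
  mu_nonneg : 0 ≤ μ
  strongConcave : ∀ x ∈ X, StrongConcaveOn Y μ (L x)
  contDiff : ∃ U : Set (Euc m × Euc n), IsOpen U ∧ X ×ˢ Y ⊆ U ∧
    ContDiffOn ℝ 1 (fun p : Euc m × Euc n => L p.1 p.2) U
  Lxx_nonneg : 0 ≤ Lxx
  Lyy_nonneg : 0 ≤ Lyy
  Lyx_pos : 0 < Lyx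
  lipschitz_gradX : ∀ x ∈ X, ∀ y ∈ Y, ∀ x' ∈ X, ∀ y' ∈ Y,
    ‖gradX L x y - gradX L x' y'‖ ≤ Lxx * ‖x - x'‖ + Lyx * ‖y - y'‖
  lipschitz_gradY : ∀ x ∈ X, ∀ y ∈ Y, ∀ x' ∈ X, ∀ y' ∈ Y,
    ‖gradY L x y - gradY L x' y'‖ ≤ Lyx * ‖x - x'‖ + Lyy * ‖y - y'‖

/-- `L` is convex-concave over `X × Y`. -/
def ConvexConcave {m n : ℕ} (X : Set (Euc m)) (Y : Set (Euc n)) (L : Euc m → Euc n → ℝ) :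
    Prop :=
  (∀ y ∈ Y, ConvexOn ℝ X (fun x => L x y)) ∧ ∀ x ∈ X, ConcaveOn ℝ Y (L x)

/-- `Y` is an `α`-strongly convex set for the modulus `α > 0`. -/
def StronglyConvexSet {n : ℕ} (α : ℝ) (Y : Set (Euc n)) : Prop :=
  0 < α ∧ ∀ y ∈ Y, ∀ y' ∈ Y, ∀ z : Euc n, ‖z‖ = 1 → ∀ ξ : ℝ, 0 ≤ ξ → ξ ≤ 1 →
    ξ • y + (1 - ξ) • y' + (ξ * (1 - ξ) * (α / 2) * ‖y - y'‖ ^ 2) • z ∈ Y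

/-- `v` is a possible answer of the linear minimization oracle of `U` in the direction `d`,
that is, `v ∈ argmin_{w ∈ U} dᵀ w`. -/
def IsLMO {n : ℕ} (U : Set (Euc n)) (d v : Euc n) : Prop :=
  v ∈ U ∧ ∀ w ∈ U, inner ℝ d v ≤ inner ℝ d w

/-- The dual stepsize `min {∇_y L_β(x, y)ᵀ (u - y) / ((L_yy + β) ‖u - y‖²), 1}`, where `d` stands
for `∇_y L_β(x, y)`. The quotient can have denominator zero only if `u = y` or `Lyy + β = 0`. In
the first case the stepsize has no effect on the update, and the second one forces `u = y`
when `L(x, ·)` is `μ`-strongly concave with `max {β, μ} > 0`. -/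
def dualStep {n : ℕ} (Lyy β : ℝ) (d u y : Euc n) : ℝ :=
  min (inner ℝ d (u - y) / ((Lyy + β) * ‖u - y‖ ^ 2)) 1

/-- `(x_t, y_t)` is a sequence generated by the LMO-LMO algorithm with stepsizes `τ_t` and
smoothing parameters `β_t`, for some admissible choice of the oracle answers `v_t`, `u_t`.
The reference point of the regularization is the initial point `y 0`. -/
def IsLMOLMO {m n : ℕ} (X : Set (Euc m)) (Y : Set (Euc n)) (L : Euc m → Euc n → ℝ) (Lyy : ℝ)
    (τ β : ℕ → ℝ) (x : ℕ → Euc m) (y : ℕ → Euc n) : Prop :=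
  x 0 ∈ X ∧ y 0 ∈ Y ∧ ∀ t : ℕ,
    (∃ v : Euc m, IsLMO X (gradX L (x t) (y t)) v ∧
      x (t + 1) = x t + τ t • (v - x t)) ∧
    ∃ u : Euc n, IsLMO Y (-gradY (regPayoff L (y 0) (β t)) (x t) (y t)) u ∧
      y (t + 1) = y t +
        dualStep Lyy (β t) (gradY (regPayoff L (y 0) (β t)) (x t) (y t)) u (y t) • (u - y t)

/-- The schedule `τ_t = (t + 1)^{-a}` of the primal stepsizes. -/
def stepSize (a : ℝ) (t : ℕ) : ℝ := ((t : ℝ) + 1) ^ (-a)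

/-- The schedule `β_t = C (t + 1)^{-b}` of the smoothing parameters. -/
def smoothing (C b : ℝ) (t : ℕ) : ℝ := C * ((t : ℝ) + 1) ^ (-b)

/-- The primal function `f(x) = max_{y ∈ Y} L(x, y)`. -/
def primalFn {m n : ℕ} (Y : Set (Euc n)) (L : Euc m → Euc n → ℝ) (x : Euc m) : ℝ :=
  sSup (L x '' Y)

/-- The primal optimality gap `f(x) - min_{v ∈ X} f(v)`. -/
def gapOpt {m n : ℕ} (X : Set (Euc m)) (Y : Set (Euc n)) (L : Euc m → Euc n → ℝ)
    (x : Euc m) : ℝ :=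
  primalFn Y L x - sInf (primalFn Y L '' X)

/-- The dual gap `G_Y(x, y) = max_{u ∈ Y} L(x, u) - L(x, y)`. -/
def gapDual {m n : ℕ} (Y : Set (Euc n)) (L : Euc m → Euc n → ℝ) (x : Euc m) (y : Euc n) : ℝ :=
  sSup (L x '' Y) - L x y

end

end MinimaxLMO

/-! The proof follows the dual gap `h t` of the regularized payoff at `(x t, y t)`. Regularization
turns `L` into a payoff with the same structure, with constants `Lyy + β` and `μ + β`, so every
one-step estimate is proved for a plain strongly concave payoff and transferred by
`Smooth.regularize`.

Write `N = t + 1` and let the total strong concavity modulus be at least `s * N ^ (-b)`. A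
Frank–Wolfe step in `y` lowers the gap by a multiple of `h ^ 2` in general, and of the square root
of the modulus times `h ^ (3 / 2)` when `Y` is strongly convex. The step in `x` then raises the gap
by at most a multiple of `d / N`, where `d` is the distance from the new `y` to the new maximizer.
Strong concavity bounds `d ^ 2` by the gap over the modulus, so this drift is of order `N ^ (b / 2 -
1) * √h` plus a smaller term; it is this square root that makes the rates possible. Lowering `β`
costs order `N ^ (-(b + 1))`. The resulting recursion is solved by `exists_forall_le_mul_rpow_neg`:
`h` decays like `N ^ (-p)`, with `p` determined by equating the orders of decrease and drift.

The primal value obeys an averaging recursion whose error is again proportional to a distance to a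
maximizer, now of order `N ^ (-a)` with `2 * a = p - b`. As `a ≤ 1 / 2`, averaging preserves this
order (`le_mul_rpow_neg_of_average`). Removing the regularization at time `T` adds a bias of order
`T ^ (-b)`. All cases are instances of `exists_rate_of_decrease`. The argument needs no logarithm;
the logarithmic factor in the theorem only weakens the bounds. -/

namespace MinimaxLMO

/-! ### Smoothness and strong concavity inequalities on a convex set -/

section Gradient

variable {E : Type*} [NormedAddCommGroup E] [InnerProductSpace ℝ E] [CompleteSpace E]

theorem hasGradientAt_const_mul_norm_sub_sq (c : ℝ) (y z : E) :
    HasGradientAt (fun w => c / 2 * ‖w - y‖ ^ 2) (c • (z - y)) z := by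
  rw [hasGradientAt_iff_hasFDerivAt]
  have h := ((hasFDerivAt_id z).sub_const y).norm_sq.const_mul (c / 2)
  refine h.congr_fderiv ?_
  ext w
  simp
  ring

theorem hasGradientAt_add {F H : E → ℝ} {a b z : E} (hF : HasGradientAt F a z)
    (hH : HasGradientAt H b z) : HasGradientAt (fun w => F w + H w) (a + b) z := by
  rw [hasGradientAt_iff_hasFDerivAt] at *
  rw [map_add]
  exact hF.add hH

theorem hasGradientAt_sub {F H : E → ℝ} {a b z : E} (hF : HasGradientAt F a z)
    (hH : HasGradientAt H b z) : HasGradientAt (fun w => F w - H w) (a - b) z := by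
  rw [hasGradientAt_iff_hasFDerivAt] at *
  rw [map_sub]
  exact hF.sub hH

theorem hasGradientAt_neg {F : E → ℝ} {a z : E} (hF : HasGradientAt F a z) :
    HasGradientAt (fun w => -F w) (-a) z := by
  rw [hasGradientAt_iff_hasFDerivAt] at *
  rw [map_neg]
  exact hF.neg

theorem hasDerivAt_line_of_hasGradientAt {F : E → ℝ} {g y d : E} {s : ℝ}
    (hF : HasGradientAt F g (y + s • d)) :
    HasDerivAt (fun r : ℝ => F (y + r • d)) (inner ℝ g d) s := by
  rw [hasGradientAt_iff_hasFDerivAt] at hF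
  have h1 : HasDerivAt (fun r : ℝ => y + r • d) d s := by
    simpa using ((hasDerivAt_id s).smul_const d).const_add y
  have h2 := hF.comp_hasDerivAt s h1
  rw [InnerProductSpace.toDual_apply_apply] at h2
  exact h2

/-- Mean value theorem along a segment of a convex set. -/
theorem exists_inner_gradient_eq_sub {S : Set E} (hS : Convex ℝ S) {F : E → ℝ} {G : E → E}
    (hG : ∀ z ∈ S, HasGradientAt F (G z) z) {y u : E} (hy : y ∈ S) (hu : u ∈ S) :
    ∃ c : ℝ, 0 ≤ c ∧ c ≤ 1 ∧ y + c • (u - y) ∈ S ∧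
      F u - F y = inner ℝ (G (y + c • (u - y))) (u - y) := by
  have hmem : ∀ s ∈ Set.Icc (0 : ℝ) 1, y + s • (u - y) ∈ S := fun s hs =>
    hS.add_smul_sub_mem hy hu hs
  have hd : ∀ s ∈ Set.Icc (0 : ℝ) 1, HasDerivAt (fun r : ℝ => F (y + r • (u - y)))
      (inner ℝ (G (y + s • (u - y))) (u - y)) s := fun s hs =>
    hasDerivAt_line_of_hasGradientAt (hG _ (hmem s hs))
  obtain ⟨c, hc, h⟩ := exists_hasDerivAt_eq_slope (fun r : ℝ => F (y + r • (u - y)))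
    (fun s => inner ℝ (G (y + s • (u - y))) (u - y)) one_pos
    (fun s hs => (hd s hs).continuousAt.continuousWithinAt)
    (fun s hs => hd s (Set.Ioo_subset_Icc_self hs))
  refine ⟨c, hc.1.le, hc.2.le, hmem c (Set.Ioo_subset_Icc_self hc), ?_⟩
  rw [h]
  simp

/-- Adding `ℓ / 2 * ‖w - y‖ ^ 2` to `F` makes the mean value theorem produce the sharp constant: at
the intermediate point the Lipschitz error `ℓ * c * ‖u - y‖ ^ 2` is cancelled exactly by the
gradient of the added term. -/
theorem le_sub_of_lipschitz_gradient {S : Set E} (hS : Convex ℝ S) {F : E → ℝ} {G : E → E}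
    {ℓ : ℝ} (hG : ∀ z ∈ S, HasGradientAt F (G z) z)
    (hL : ∀ z ∈ S, ∀ w ∈ S, ‖G z - G w‖ ≤ ℓ * ‖z - w‖) {y u : E} (hy : y ∈ S) (hu : u ∈ S) :
    inner ℝ (G y) (u - y) - ℓ / 2 * ‖u - y‖ ^ 2 ≤ F u - F y := by
  obtain ⟨c, hc0, -, hcS, h⟩ := exists_inner_gradient_eq_sub hS
    (F := fun w => F w + ℓ / 2 * ‖w - y‖ ^ 2) (G := fun z => G z + ℓ • (z - y))
    (fun z hz => hasGradientAt_add (hG z hz) (hasGradientAt_const_mul_norm_sub_sq ℓ y z)) hy hu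
  have h1 := (abs_le.1 (abs_real_inner_le_norm (G (y + c • (u - y)) - G y) (u - y))).1
  have h2 := hL _ hcS _ hy
  rw [add_sub_cancel_left, norm_smul, Real.norm_of_nonneg hc0] at h2
  have h3 := mul_le_mul_of_nonneg_right h2 (norm_nonneg (u - y))
  rw [inner_sub_left] at h1
  simp only [inner_add_left, add_sub_cancel_left, inner_smul_left, sub_self, norm_zero,
    real_inner_self_eq_norm_sq, RCLike.conj_to_real] at h
  nlinarith [h, h1, h3]

theorem sub_le_of_lipschitz_gradient {S : Set E} (hS : Convex ℝ S) {F : E → ℝ} {G : E → E}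
    {ℓ : ℝ} (hG : ∀ z ∈ S, HasGradientAt F (G z) z)
    (hL : ∀ z ∈ S, ∀ w ∈ S, ‖G z - G w‖ ≤ ℓ * ‖z - w‖) {y u : E} (hy : y ∈ S) (hu : u ∈ S) :
    F u - F y ≤ inner ℝ (G y) (u - y) + ℓ / 2 * ‖u - y‖ ^ 2 := by
  have h := le_sub_of_lipschitz_gradient hS (F := fun w => -F w) (G := fun w => -G w) (ℓ := ℓ)
    (fun z hz => hasGradientAt_neg (hG z hz))
    (fun z hz w hw => by rw [← neg_sub_neg, neg_neg, neg_neg, norm_sub_rev, norm_sub_rev];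
                         simpa [norm_sub_rev] using hL z hz w hw) hy hu
  rw [inner_neg_left] at h
  linarith

/-- Divide the strong concavity inequality on the segment from `y` to `u` by the parameter `s` and
let `s` tend to zero from the right. -/
theorem _root_.StrongConcaveOn.sub_add_le_inner_gradient {S : Set E} {F : E → ℝ} {m : ℝ} {g y u : E}
    (hF : StrongConcaveOn S m F) (hg : HasGradientAt F g y) (hy : y ∈ S) (hu : u ∈ S) :
    F u - F y + m / 2 * ‖u - y‖ ^ 2 ≤ inner ℝ g (u - y) := by
  have hd : HasDerivAt (fun r : ℝ => F (y + r • (u - y))) (inner ℝ g (u - y)) 0 :=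
    hasDerivAt_line_of_hasGradientAt (by simpa using hg)
  have ht : Filter.Tendsto (fun s : ℝ => s⁻¹ * (F (y + s • (u - y)) - F y)
      + s * (m / 2 * ‖u - y‖ ^ 2)) (nhdsWithin 0 (Set.Ioi 0))
      (nhds (inner ℝ g (u - y) + 0 * (m / 2 * ‖u - y‖ ^ 2))) := by
    refine Filter.Tendsto.add ?_ ?_
    · have := hd.tendsto_slope_zero_right
      simpa using this
    · exact (Filter.Tendsto.mul_const _ Filter.tendsto_id).mono_left nhdsWithin_le_nhds
  rw [zero_mul, add_zero] at ht
  refine ge_of_tendsto ht ?_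
  filter_upwards [Ioo_mem_nhdsGT (zero_lt_one' ℝ)] with s hs
  have h := hF.2 hu hy hs.1.le (sub_nonneg.2 hs.2.le) (by ring)
  have he : s • u + (1 - s) • y = y + s • (u - y) := by module
  rw [he] at h
  simp only [smul_eq_mul] at h
  have h2 : s * (F u - F y + m / 2 * ‖u - y‖ ^ 2 - s * (m / 2 * ‖u - y‖ ^ 2))
      ≤ F (y + s • (u - y)) - F y := by linarith
  have h3 := mul_le_mul_of_nonneg_left h2 (inv_nonneg.2 hs.1.le)
  rw [inv_mul_cancel_left₀ hs.1.ne'] at h3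
  linarith

theorem _root_.ConvexOn.inner_gradient_le_sub {S : Set E} {F : E → ℝ} {g y u : E}
    (hF : ConvexOn ℝ S F) (hg : HasGradientAt F g y) (hy : y ∈ S) (hu : u ∈ S) :
    inner ℝ g (u - y) ≤ F u - F y := by
  have h : StrongConcaveOn S 0 (fun z => -F z) := by
    rw [strongConcaveOn_zero]; exact hF.neg
  have := h.sub_add_le_inner_gradient (hasGradientAt_neg hg) hy hu
  rw [inner_neg_left] at this
  linarith

omit [CompleteSpace E] in
-- Compares the maximum with the value at the midpoint, so no differentiability is needed. The price
-- is `m / 4` in place of the optimal `m / 2`, which affects constants only.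
theorem _root_.StrongConcaveOn.mul_norm_sub_sq_le_sub {S : Set E} {F : E → ℝ} {m : ℝ} {y u : E}
    (hF : StrongConcaveOn S m F) (hy : y ∈ S) (hu : u ∈ S) (hmax : ∀ w ∈ S, F w ≤ F u) :
    m / 4 * ‖u - y‖ ^ 2 ≤ F u - F y := by
  have h := hF.2 hu hy (by norm_num : (0 : ℝ) ≤ 1 / 2) (by norm_num : (0 : ℝ) ≤ 1 / 2) (by norm_num)
  have h' := hmax _ (hF.1 hu hy (by norm_num : (0 : ℝ) ≤ 1 / 2) (by norm_num : (0 : ℝ) ≤ 1 / 2)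
    (by norm_num))
  simp only [smul_eq_mul] at h
  linarith

end Gradient

/-! ### Consequences of the standing assumptions; regularization -/

section Smooth

variable {m n : ℕ} {X : Set (Euc m)} {Y : Set (Euc n)} {L : Euc m → Euc n → ℝ}
  {Lxx Lyx Lyy μ DX DY : ℝ}

theorem gradX_regPayoff (L : Euc m → Euc n → ℝ) (y₀ : Euc n) (β : ℝ) (x : Euc m) (y : Euc n) :
    gradX (regPayoff L y₀ β) x y = gradX L x y := by
  simp only [gradX, regPayoff, gradient]
  rw [fderiv_sub_const]

namespace Smooth

theorem differentiableAt (hS : Smooth X Y L Lxx Lyx Lyy μ DX DY) {x : Euc m} {y : Euc n}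
    (hx : x ∈ X) (hy : y ∈ Y) :
    DifferentiableAt ℝ (fun p : Euc m × Euc n => L p.1 p.2) (x, y) := by
  obtain ⟨U, hU, hsub, hc⟩ := hS.contDiff
  exact (hc.differentiableOn one_ne_zero).differentiableAt (hU.mem_nhds (hsub ⟨hx, hy⟩))

theorem hasGradientAt_gradX (hS : Smooth X Y L Lxx Lyx Lyy μ DX DY) {x : Euc m} {y : Euc n}
    (hx : x ∈ X) (hy : y ∈ Y) : HasGradientAt (fun x' => L x' y) (gradX L x y) x := by
  have h : DifferentiableAt ℝ (fun x' => L x' y) x :=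
    (hS.differentiableAt hx hy).comp x
      (f := fun x' => (x', y)) (differentiableAt_id.prodMk (differentiableAt_const y))
  exact h.hasGradientAt

theorem hasGradientAt_gradY (hS : Smooth X Y L Lxx Lyx Lyy μ DX DY) {x : Euc m} {y : Euc n}
    (hx : x ∈ X) (hy : y ∈ Y) : HasGradientAt (L x) (gradY L x y) y := by
  have h : DifferentiableAt ℝ (fun y' => L x y') y :=
    (hS.differentiableAt hx hy).comp y
      (f := fun y' => (x, y')) ((differentiableAt_const x).prodMk differentiableAt_id)
  exact h.hasGradientAt

theorem exists_max (hS : Smooth X Y L Lxx Lyx Lyy μ DX DY) (hne : Y.Nonempty) {x : Euc m}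
    (hx : x ∈ X) : ∃ u ∈ Y, primalFn Y L x = L x u ∧ ∀ w ∈ Y, L x w ≤ L x u := by
  obtain ⟨u, hu, hmax⟩ := hS.compact_Y.exists_isMaxOn hne
    (fun y hy => (hS.hasGradientAt_gradY hx hy).hasFDerivAt.continuousAt.continuousWithinAt)
  refine ⟨u, hu, ?_, hmax⟩
  refine IsGreatest.csSup_eq ⟨⟨u, hu, rfl⟩, ?_⟩
  rintro _ ⟨w, hw, rfl⟩
  exact hmax hw

theorem norm_sub_le_diamX (hS : Smooth X Y L Lxx Lyx Lyy μ DX DY) {x x' : Euc m}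
    (hx : x ∈ X) (hx' : x' ∈ X) : ‖x - x'‖ ≤ DX := by
  rw [← dist_eq_norm, ← hS.diam_X]
  exact Metric.dist_le_diam_of_mem hS.compact_X.isBounded hx hx'

theorem norm_sub_le_diamY (hS : Smooth X Y L Lxx Lyx Lyy μ DX DY) {y y' : Euc n}
    (hy : y ∈ Y) (hy' : y' ∈ Y) : ‖y - y'‖ ≤ DY := by
  rw [← dist_eq_norm, ← hS.diam_Y]
  exact Metric.dist_le_diam_of_mem hS.compact_Y.isBounded hy hy'

theorem diamX_nonneg (hS : Smooth X Y L Lxx Lyx Lyy μ DX DY) : 0 ≤ DX :=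
  hS.diam_X ▸ Metric.diam_nonneg

theorem diamY_nonneg (hS : Smooth X Y L Lxx Lyx Lyy μ DX DY) : 0 ≤ DY :=
  hS.diam_Y ▸ Metric.diam_nonneg

theorem gradX_lipschitz_fst (hS : Smooth X Y L Lxx Lyx Lyy μ DX DY) {x x' : Euc m} {y : Euc n}
    (hx : x ∈ X) (hx' : x' ∈ X) (hy : y ∈ Y) :
    ‖gradX L x y - gradX L x' y‖ ≤ Lxx * ‖x - x'‖ := by
  simpa using hS.lipschitz_gradX x hx y hy x' hx' y hy

theorem gradX_lipschitz_snd (hS : Smooth X Y L Lxx Lyx Lyy μ DX DY) {x : Euc m} {y y' : Euc n}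
    (hx : x ∈ X) (hy : y ∈ Y) (hy' : y' ∈ Y) :
    ‖gradX L x y - gradX L x y'‖ ≤ Lyx * ‖y - y'‖ := by
  simpa using hS.lipschitz_gradX x hx y hy x hx y' hy'

theorem gradY_lipschitz_snd (hS : Smooth X Y L Lxx Lyx Lyy μ DX DY) {x : Euc m} {y y' : Euc n}
    (hx : x ∈ X) (hy : y ∈ Y) (hy' : y' ∈ Y) :
    ‖gradY L x y - gradY L x y'‖ ≤ Lyy * ‖y - y'‖ := by
  simpa using hS.lipschitz_gradY x hx y hy x hx y' hy'

/-- The mixed second difference is controlled by the cross Lipschitz constant. -/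
theorem mixed_sub_le (hS : Smooth X Y L Lxx Lyx Lyy μ DX DY) {x x' : Euc m} {y u : Euc n}
    (hx : x ∈ X) (hx' : x' ∈ X) (hy : y ∈ Y) (hu : u ∈ Y) :
    (L x' u - L x' y) - (L x u - L x y) ≤ Lyx * ‖x' - x‖ * ‖u - y‖ := by
  obtain ⟨c, -, -, hc, h⟩ := exists_inner_gradient_eq_sub hS.convex_X
    (F := fun z => L z u - L z y) (G := fun z => gradX L z u - gradX L z y)
    (fun z hz => hasGradientAt_sub (hS.hasGradientAt_gradX hz hu) (hS.hasGradientAt_gradX hz hy))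
    hx hx'
  rw [h]
  refine (real_inner_le_norm _ _).trans ?_
  have := mul_le_mul_of_nonneg_right (hS.gradX_lipschitz_snd hc hu hy) (norm_nonneg (x' - x))
  linarith

/-- The quadratic penalty adds `β` to both the `y`-smoothness and the strong concavity modulus and
leaves `gradX` untouched. The sum `Lyy + β` is exactly the constant in the dual stepsize. -/
theorem regularize (hS : Smooth X Y L Lxx Lyx Lyy μ DX DY) (y₀ : Euc n) {β : ℝ} (hβ : 0 ≤ β) :
    Smooth X Y (regPayoff L y₀ β) Lxx Lyx (Lyy + β) (μ + β) DX DY := by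
  have hgY : ∀ x ∈ X, ∀ y ∈ Y, gradY (regPayoff L y₀ β) x y = gradY L x y - β • (y - y₀) :=
    fun x hx y hy => (hasGradientAt_sub (hS.hasGradientAt_gradY hx hy)
      (hasGradientAt_const_mul_norm_sub_sq β y₀ y)).gradient
  exact {
    hS with
    mu_nonneg := add_nonneg hS.mu_nonneg hβ
    Lyy_nonneg := add_nonneg hS.Lyy_nonneg hβ
    strongConcave := by
      intro x hx
      have h1 := strongConcaveOn_iff_convex.1 (hS.strongConcave x hx)
      rw [strongConcaveOn_iff_convex]
      have h2 : ConcaveOn ℝ Y (fun y => (β • innerSL ℝ y₀ : Euc n →L[ℝ] ℝ).toLinearMap y) :=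
        LinearMap.concaveOn _ hS.convex_Y
      refine ((h1.add h2).add_const (- (β / 2 * ‖y₀‖ ^ 2))).congr ?_
      intro y _
      simp [regPayoff, norm_sub_sq_real, real_inner_comm]
      ring
    contDiff := by
      obtain ⟨U, hU, hsub, hc⟩ := hS.contDiff
      refine ⟨U, hU, hsub, hc.sub ?_⟩
      refine ContDiff.contDiffOn ?_
      exact contDiff_const.mul ((contDiff_snd.sub contDiff_const).norm_sq ℝ)
    lipschitz_gradX := by
      intro x hx y hy x' hx' y' hy'
      rw [gradX_regPayoff, gradX_regPayoff]
      exact hS.lipschitz_gradX x hx y hy x' hx' y' hy'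
    lipschitz_gradY := by
      intro x hx y hy x' hx' y' hy'
      rw [hgY x hx y hy, hgY x' hx' y' hy']
      have h1 := hS.lipschitz_gradY x hx y hy x' hx' y' hy'
      have h2 : gradY L x y - β • (y - y₀) - (gradY L x' y' - β • (y' - y₀))
        = (gradY L x y - gradY L x' y') - β • (y - y') := by module
      have h3 := norm_sub_le (gradY L x y - gradY L x' y') (β • (y - y'))
      rw [norm_smul, Real.norm_of_nonneg hβ] at h3
      rw [h2]
      linarith }

end Smooth

theorem ConvexConcave.regularize_convexOn (hC : ConvexConcave X Y L) (y₀ : Euc n) (β : ℝ)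
    {y : Euc n} (hy : y ∈ Y) : ConvexOn ℝ X (fun x => regPayoff L y₀ β x y) := by
  refine ((hC.1 y hy).add_const (-(β / 2 * ‖y - y₀‖ ^ 2))).congr fun x _ => ?_
  simp [regPayoff, sub_eq_add_neg]

end Smooth

/-! ### One step of the algorithm -/

section Steps

variable {m n : ℕ} {X : Set (Euc m)} {Y : Set (Euc n)} {L : Euc m → Euc n → ℝ}
  {Lxx Lyx Lyy μ DX DY : ℝ}

theorem gapDual_eq (Y : Set (Euc n)) (L : Euc m → Euc n → ℝ) (x : Euc m) (y : Euc n) :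
    gapDual Y L x y = primalFn Y L x - L x y := rfl

namespace Smooth

theorem le_primalFn (hS : Smooth X Y L Lxx Lyx Lyy μ DX DY) {x : Euc m} {y : Euc n}
    (hx : x ∈ X) (hy : y ∈ Y) : L x y ≤ primalFn Y L x := by
  obtain ⟨u, -, h, hmax⟩ := hS.exists_max ⟨y, hy⟩ hx
  exact h ▸ hmax y hy

theorem gapDual_nonneg (hS : Smooth X Y L Lxx Lyx Lyy μ DX DY) {x : Euc m} {y : Euc n}
    (hx : x ∈ X) (hy : y ∈ Y) : 0 ≤ gapDual Y L x y :=
  sub_nonneg.2 (hS.le_primalFn hx hy)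

/-- The dual gap varies with `x` at most in proportion to the distance of `y` to a maximizer. -/
theorem exists_gapDual_le_add (hS : Smooth X Y L Lxx Lyx Lyy μ DX DY) {x x' : Euc m} {y : Euc n}
    (hx : x ∈ X) (hx' : x' ∈ X) (hy : y ∈ Y) :
    ∃ d, 0 ≤ d ∧ d ≤ DY ∧ μ / 4 * d ^ 2 ≤ gapDual Y L x' y ∧
      gapDual Y L x' y ≤ gapDual Y L x y + Lyx * ‖x' - x‖ * d := by
  obtain ⟨u, hu, h, hmax⟩ := hS.exists_max ⟨y, hy⟩ hx'
  refine ⟨‖u - y‖, norm_nonneg _, hS.norm_sub_le_diamY hu hy, ?_, ?_⟩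
  · rw [gapDual_eq, h]
    exact (hS.strongConcave x' hx').mul_norm_sub_sq_le_sub hy hu hmax
  · rw [gapDual_eq, gapDual_eq, h]
    have h1 := hS.mixed_sub_le hx hx' hy hu
    have h2 := hS.le_primalFn hx hu
    linarith

/-- Here `d` is the distance from `y` to a maximizer `u` at the new point, so that the new primal
value is `L x' u` and no derivative of `primalFn` is needed. Smoothness and convexity of `L · u`
give a Frank–Wolfe estimate; exchanging `gradX L x u` for `gradX L x y` before using the oracle, and
back after it, costs `Lyx * d * DX` each time. -/
theorem exists_primalFn_step_le (hS : Smooth X Y L Lxx Lyx Lyy μ DX DY)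
    (hC : ∀ y ∈ Y, ConvexOn ℝ X fun x => L x y) {x v w : Euc m} {y : Euc n} {τ : ℝ}
    (hx : x ∈ X) (hw : w ∈ X) (hy : y ∈ Y) (hv : IsLMO X (gradX L x y) v)
    (hτ0 : 0 ≤ τ) (hτ1 : τ ≤ 1) :
    ∃ d, 0 ≤ d ∧ d ≤ DY ∧ μ / 4 * d ^ 2 ≤ gapDual Y L x y + Lyx * DX * τ * d ∧
      primalFn Y L (x + τ • (v - x)) ≤ (1 - τ) * primalFn Y L x + τ * primalFn Y L w
        + 2 * τ * (Lyx * DX) * d + Lxx / 2 * τ ^ 2 * DX ^ 2 := by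
  have hx' : x + τ • (v - x) ∈ X := hS.convex_X.add_smul_sub_mem hx hv.1 ⟨hτ0, hτ1⟩
  obtain ⟨u, hu, h, hmax⟩ := hS.exists_max ⟨y, hy⟩ hx'
  have hLyx := hS.Lyx_pos.le
  have hDX := hS.norm_sub_le_diamX hv.1 hx
  have hDX0 := hS.diamX_nonneg
  have hnorm : ‖x + τ • (v - x) - x‖ = τ * ‖v - x‖ := by
    rw [add_sub_cancel_left, norm_smul, Real.norm_of_nonneg hτ0]
  refine ⟨‖u - y‖, norm_nonneg _, hS.norm_sub_le_diamY hu hy, ?_, ?_⟩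
  · have h0 := (hS.strongConcave _ hx').mul_norm_sub_sq_le_sub hy hu hmax
    have h1 := hS.mixed_sub_le hx hx' hy hu
    have h2 := hS.le_primalFn hx hu
    rw [hnorm] at h1
    have h3 : Lyx * (τ * ‖v - x‖) * ‖u - y‖ ≤ Lyx * (τ * DX) * ‖u - y‖ := by gcongr
    rw [gapDual_eq]
    linarith
  · have h1 := sub_le_of_lipschitz_gradient hS.convex_X (F := fun z => L z u)
      (G := fun z => gradX L z u) (fun z hz => hS.hasGradientAt_gradX hz hu)
      (fun z hz z' hz' => hS.gradX_lipschitz_fst hz hz' hu) hx hx'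
    rw [hnorm, add_sub_cancel_left, inner_smul_right] at h1
    have hlip := hS.gradX_lipschitz_snd hx hu hy
    have h2 : inner ℝ (gradX L x u) (v - x)
        ≤ inner ℝ (gradX L x y) (v - x) + Lyx * ‖u - y‖ * DX := by
      have h := real_inner_le_norm (gradX L x u - gradX L x y) (v - x)
      rw [inner_sub_left] at h
      have : ‖gradX L x u - gradX L x y‖ * ‖v - x‖ ≤ Lyx * ‖u - y‖ * DX := by gcongr
      linarith
    have h3 : inner ℝ (gradX L x y) (v - x) ≤ inner ℝ (gradX L x y) (w - x) := by
      rw [inner_sub_right, inner_sub_right]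
      linarith [hv.2 w hw]
    have h4 : inner ℝ (gradX L x y) (w - x)
        ≤ inner ℝ (gradX L x u) (w - x) + Lyx * ‖u - y‖ * DX := by
      have h := real_inner_le_norm (gradX L x y - gradX L x u) (w - x)
      rw [inner_sub_left, norm_sub_rev] at h
      have h' := hS.norm_sub_le_diamX hw hx
      have : ‖gradX L x u - gradX L x y‖ * ‖w - x‖ ≤ Lyx * ‖u - y‖ * DX := by gcongr
      linarith
    have h5 := (hC u hu).inner_gradient_le_sub (hS.hasGradientAt_gradX hx hu) hx hw
    have h6 := hS.le_primalFn hx hu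
    have h7 := hS.le_primalFn hw hu
    have h8 : τ * inner ℝ (gradX L x u) (v - x)
        ≤ τ * (primalFn Y L w - L x u + 2 * (Lyx * ‖u - y‖ * DX)) := by
      gcongr; linarith
    have h9 : Lxx / 2 * (τ * ‖v - x‖) ^ 2 ≤ Lxx / 2 * (τ * DX) ^ 2 := by
      have := hS.Lxx_nonneg
      gcongr
    have h10 := mul_le_mul_of_nonneg_left h6 (sub_nonneg.2 hτ1)
    rw [h]
    linarith

/-- The raw decrease of the dual gap in a Frank--Wolfe step with the short stepsize. -/
theorem dual_step (hS : Smooth X Y L Lxx Lyx Lyy μ DX DY) (hμ : 0 < μ) {x : Euc m}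
    {y u : Euc n} (hx : x ∈ X) (hy : y ∈ Y) (hu : IsLMO Y (-gradY L x y) u) {γ : ℝ}
    (hγ : γ = min (inner ℝ (gradY L x y) (u - y) / (Lyy * ‖u - y‖ ^ 2)) 1) :
    y + γ • (u - y) ∈ Y ∧ gapDual Y L x y ≤ inner ℝ (gradY L x y) (u - y) ∧
    gapDual Y L x (y + γ • (u - y)) ≤ Lyy * DY ^ 2 ∧
    gapDual Y L x (y + γ • (u - y)) ≤ gapDual Y L x y ∧
    (gapDual Y L x (y + γ • (u - y)) ≤ gapDual Y L x y - inner ℝ (gradY L x y) (u - y) / 2 ∨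
      (0 < Lyy ∧ 0 < ‖u - y‖ ∧ gapDual Y L x (y + γ • (u - y)) ≤ gapDual Y L x y -
        inner ℝ (gradY L x y) (u - y) ^ 2 / (2 * Lyy * ‖u - y‖ ^ 2))) := by
  have hopt : ∀ w ∈ Y, inner ℝ (gradY L x y) w ≤ inner ℝ (gradY L x y) u := by
    intro w hw
    have := hu.2 w hw
    rw [inner_neg_left, inner_neg_left] at this
    linarith
  have hgap : gapDual Y L x y ≤ inner ℝ (gradY L x y) (u - y) := by
    obtain ⟨w, hw, h, -⟩ := hS.exists_max ⟨y, hy⟩ hx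
    have h1 := (hS.strongConcave x hx).sub_add_le_inner_gradient (hS.hasGradientAt_gradY hx hy)
      hy hw
    have h2 := hopt w hw
    rw [gapDual_eq, h, inner_sub_right]
    rw [inner_sub_right] at h1
    have : 0 ≤ μ / 2 * ‖w - y‖ ^ 2 := by positivity
    linarith
  have hg0 := (hS.gapDual_nonneg hx hy).trans hgap
  have hDYd := hS.norm_sub_le_diamY hu.1 hy
  have hℓ0 := hS.Lyy_nonneg
  have hDY0 := hS.diamY_nonneg
  have hsm : ∀ z ∈ Y, inner ℝ (gradY L x y) (z - y) - Lyy / 2 * ‖z - y‖ ^ 2 ≤ L x z - L x y :=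
    fun z hz => le_sub_of_lipschitz_gradient hS.convex_Y
      (fun z hz => hS.hasGradientAt_gradY hx hz)
      (fun z hz z' hz' => hS.gradY_lipschitz_snd hx hz hz') hy hz
  set g := inner ℝ (gradY L x y) (u - y) with hg
  rcases eq_or_ne u y with rfl | hne
  · have hg' : g = 0 := by simp [hg]
    have h0 : (0 : ℝ) ≤ Lyy * DY ^ 2 := by positivity
    simp only [sub_self, smul_zero, add_zero, hg'] at hgap ⊢
    exact ⟨hy, hgap, hgap.trans h0, le_rfl, Or.inl (by simp)⟩
  have hd : 0 < ‖u - y‖ := norm_pos_iff.2 (sub_ne_zero.2 hne)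
  -- If `Lyy` were zero, `L x` would grow at least linearly from `y` to `u`, against strong
  -- concavity. Hence the quotient in the stepsize is genuine.
  have hℓ : 0 < Lyy := by
    have h1 := hsm u hu.1
    have h2 := (hS.strongConcave x hx).sub_add_le_inner_gradient (hS.hasGradientAt_gradY hx hy)
      hy hu.1
    by_contra hcon
    have h3 : Lyy = 0 := le_antisymm (not_lt.1 hcon) hℓ0
    have h4 : 0 < μ / 2 * ‖u - y‖ ^ 2 := by positivity
    rw [h3] at h1
    linarith
  have hden : 0 < Lyy * ‖u - y‖ ^ 2 := by positivity
  have hγ0 : 0 ≤ γ := hγ ▸ le_min (div_nonneg hg0 hden.le) zero_le_one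
  have hmem : y + γ • (u - y) ∈ Y :=
    hS.convex_Y.add_smul_sub_mem hy hu.1 ⟨hγ0, hγ ▸ min_le_right _ _⟩
  have hgain := hsm _ hmem
  rw [add_sub_cancel_left, inner_smul_right, norm_smul, Real.norm_of_nonneg hγ0, mul_pow,
    ← hg] at hgain
  have hsq : Lyy * ‖u - y‖ ^ 2 ≤ Lyy * DY ^ 2 := by gcongr
  rcases le_total (Lyy * ‖u - y‖ ^ 2) g with hcase | hcase
  · have hγ1 : γ = 1 := by
      rw [hγ, min_eq_right]
      rwa [one_le_div hden]
    rw [hγ1] at hgain hmem ⊢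
    have hdec : gapDual Y L x (y + (1 : ℝ) • (u - y)) ≤ gapDual Y L x y - g / 2 := by
      rw [gapDual_eq, gapDual_eq]
      linarith
    refine ⟨hmem, hgap, ?_, by linarith, Or.inl hdec⟩
    -- After a full step the point is `u`, which maximizes the linear form of the old gradient. The
    -- gap at `u` therefore only sees the change of gradient, which gives a bound independent of the
    -- previous gap.
    have hyu : y + (1 : ℝ) • (u - y) = u := by simp
    rw [hyu]
    obtain ⟨w, hw, h, -⟩ := hS.exists_max ⟨y, hy⟩ hx
    have h1 := (hS.strongConcave x hx).sub_add_le_inner_gradient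
      (hS.hasGradientAt_gradY hx hu.1) hu.1 hw
    have h2 := hopt w hw
    have h3 := real_inner_le_norm (gradY L x u - gradY L x y) (w - u)
    rw [inner_sub_left, inner_sub_right (gradY L x y)] at h3
    have h4 := hS.gradY_lipschitz_snd hx hu.1 hy
    have h5 := hS.norm_sub_le_diamY hw hu.1
    have h6 : ‖gradY L x u - gradY L x y‖ * ‖w - u‖ ≤ (Lyy * DY) * DY := by
      gcongr
      exact h4.trans (by gcongr)
    have h7 : 0 ≤ μ / 2 * ‖w - u‖ ^ 2 := by positivity
    rw [gapDual_eq, h]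
    linarith
  · have hγ1 : γ = g / (Lyy * ‖u - y‖ ^ 2) := by
      rw [hγ, min_eq_left]
      rwa [div_le_one hden]
    have hdec : gapDual Y L x (y + γ • (u - y)) ≤ gapDual Y L x y -
        g ^ 2 / (2 * Lyy * ‖u - y‖ ^ 2) := by
      have he : γ * g - Lyy / 2 * (γ ^ 2 * ‖u - y‖ ^ 2) = g ^ 2 / (2 * Lyy * ‖u - y‖ ^ 2) := by
        rw [hγ1]
        field_simp
        ring
      rw [he] at hgain
      rw [gapDual_eq, gapDual_eq]
      linarith
    have h0 : 0 ≤ g ^ 2 / (2 * Lyy * ‖u - y‖ ^ 2) := by positivity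
    exact ⟨hmem, hgap, by linarith, by linarith, Or.inr ⟨hℓ, hd, hdec⟩⟩

/-- A Polyak–Łojasiewicz inequality: the gap is at most `‖gradY L x y‖ * r - μ / 2 * r ^ 2` for some
`r`, and completing the square removes `r`. -/
theorem two_mul_gapDual_le_norm_gradY_sq (hS : Smooth X Y L Lxx Lyx Lyy μ DX DY) {x : Euc m}
    {y : Euc n} (hx : x ∈ X) (hy : y ∈ Y) :
    2 * μ * gapDual Y L x y ≤ ‖gradY L x y‖ ^ 2 := by
  obtain ⟨w, hw, h, -⟩ := hS.exists_max ⟨y, hy⟩ hx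
  have h1 := (hS.strongConcave x hx).sub_add_le_inner_gradient (hS.hasGradientAt_gradY hx hy)
    hy hw
  have h2 := real_inner_le_norm (gradY L x y) (w - y)
  have h3 := hS.mu_nonneg
  have h4 : gapDual Y L x y ≤ ‖gradY L x y‖ * ‖w - y‖ - μ / 2 * ‖w - y‖ ^ 2 := by
    rw [gapDual_eq, h]; linarith
  nlinarith [mul_le_mul_of_nonneg_left h4 h3, sq_nonneg (‖gradY L x y‖ - μ * ‖w - y‖)]

end Smooth

/-- The midpoint of `u` and `y`, pushed by `α / 8 * ‖u - y‖ ^ 2` in the direction of `d`, stays in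
`Y`, and `u` does at least as well as this point. -/
theorem StronglyConvexSet.le_inner_of_isLMO {α : ℝ} (hY : StronglyConvexSet α Y) {d y u : Euc n}
    (hy : y ∈ Y) (hu : IsLMO Y (-d) u) : α / 4 * ‖u - y‖ ^ 2 * ‖d‖ ≤ inner ℝ d (u - y) := by
  rcases eq_or_ne d 0 with rfl | hd
  · simp
  have hd' : 0 < ‖d‖ := norm_pos_iff.2 hd
  have h := hu.2 _ (hY.2 u hu.1 y hy (‖d‖⁻¹ • d)
    (by rw [norm_smul, norm_inv, norm_norm, inv_mul_cancel₀ hd'.ne']) (1 / 2) (by norm_num)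
    (by norm_num))
  simp only [inner_neg_left, inner_add_right, inner_smul_right, real_inner_self_eq_norm_sq] at h
  have he : ‖d‖⁻¹ * -‖d‖ ^ 2 = -‖d‖ := by field_simp
  rw [he] at h
  rw [inner_sub_right]
  linarith

/-- A full step gains at least half the gap, which dominates the square because the gap is at most
`B`; a short step gains the square over `2 * Lyy * ‖u - y‖ ^ 2`. The summand `1` keeps the
denominator positive. -/
theorem Smooth.gapDual_step_le_quadratic (hS : Smooth X Y L Lxx Lyx Lyy μ DX DY) (hμ : 0 < μ)
    {x : Euc m} {y u : Euc n} (hx : x ∈ X) (hy : y ∈ Y) (hu : IsLMO Y (-gradY L x y) u) {γ : ℝ}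
    (hγ : γ = min (inner ℝ (gradY L x y) (u - y) / (Lyy * ‖u - y‖ ^ 2)) 1) {ℓ B : ℝ}
    (hℓ : Lyy ≤ ℓ) (hB : gapDual Y L x y ≤ B) :
    gapDual Y L x (y + γ • (u - y)) ≤
      gapDual Y L x y - 1 / (2 * (ℓ * DY ^ 2 + B + 1)) * gapDual Y L x y ^ 2 := by
  obtain ⟨-, hg, -, -, hstep⟩ := hS.dual_step hμ hx hy hu hγ
  have h0 := hS.gapDual_nonneg hx hy
  have hD := hS.norm_sub_le_diamY hu.1 hy
  have hℓ0 := hS.Lyy_nonneg.trans hℓ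
  have hD0 := hS.diamY_nonneg
  have hℓD : 0 ≤ ℓ * DY ^ 2 := by positivity
  set h := gapDual Y L x y
  have hden : 0 < 2 * (ℓ * DY ^ 2 + B + 1) := by linarith
  rw [div_mul_eq_mul_div, one_mul]
  rcases hstep with hs | ⟨hL, hd, hs⟩
  · refine hs.trans (sub_le_sub_left ?_ _)
    rw [div_le_iff₀ hden]
    nlinarith
  · refine hs.trans (sub_le_sub_left ?_ _)
    have h1 : 2 * Lyy * ‖u - y‖ ^ 2 ≤ 2 * (ℓ * DY ^ 2 + B + 1) := by
      have : Lyy * ‖u - y‖ ^ 2 ≤ ℓ * DY ^ 2 := by gcongr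
      linarith
    exact div_le_div₀ (sq_nonneg _) (by gcongr) (by positivity) h1

/-- In a short step, strong convexity of `Y` bounds one factor of `g ^ 2` below by `α / 4 * ‖u - y‖
^ 2 * ‖gradY L x y‖`. The distance cancels against the denominator, and the gradient norm is at
least `√μ * √h`. The conditions `hc1` and `hc2` serve the full and the short step respectively. -/
theorem Smooth.gapDual_step_le_of_stronglyConvexSet (hS : Smooth X Y L Lxx Lyx Lyy μ DX DY)
    (hμ : 0 < μ) {α : ℝ} (hY : StronglyConvexSet α Y)
    {x : Euc m} {y u : Euc n} (hx : x ∈ X) (hy : y ∈ Y) (hu : IsLMO Y (-gradY L x y) u) {γ : ℝ}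
    (hγ : γ = min (inner ℝ (gradY L x y) (u - y) / (Lyy * ‖u - y‖ ^ 2)) 1) {c B : ℝ}
    (hc : 0 ≤ c) (hB : gapDual Y L x y ≤ B) (hc1 : c * (√μ * √B) ≤ 1 / 2)
    (hc2 : 8 * c * Lyy ≤ α) :
    gapDual Y L x (y + γ • (u - y)) ≤
      gapDual Y L x y - c * √μ * (gapDual Y L x y * √(gapDual Y L x y)) := by
  obtain ⟨-, hg, -, -, hstep⟩ := hS.dual_step hμ hx hy hu hγ
  have h0 := hS.gapDual_nonneg hx hy
  have hα := hY.le_inner_of_isLMO hy hu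
  have hgrad : √μ * √(gapDual Y L x y) ≤ ‖gradY L x y‖ := by
    rw [← Real.sqrt_mul hμ.le]
    refine Real.sqrt_le_iff.2 ⟨norm_nonneg _, ?_⟩
    have := hS.two_mul_gapDual_le_norm_gradY_sq hx hy
    nlinarith [mul_nonneg hμ.le h0]
  set h := gapDual Y L x y
  set g := inner ℝ (gradY L x y) (u - y)
  have hg0 : 0 ≤ g := h0.trans hg
  rcases hstep with hs | ⟨hL, hd, hs⟩
  · refine hs.trans (sub_le_sub_left ?_ _)
    have h1 : c * (√μ * √h) ≤ 1 / 2 := by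
      have h2 : √h ≤ √B := Real.sqrt_le_sqrt hB
      exact le_trans (by gcongr) hc1
    nlinarith [mul_le_mul_of_nonneg_right h1 h0]
  · refine hs.trans (sub_le_sub_left ?_ _)
    rw [le_div_iff₀ (by positivity)]
    calc c * √μ * (h * √h) * (2 * Lyy * ‖u - y‖ ^ 2)
        = (8 * c * Lyy) * (‖u - y‖ ^ 2 / 4) * (√μ * √h) * h := by ring
      _ ≤ α * (‖u - y‖ ^ 2 / 4) * ‖gradY L x y‖ * g := by
          have := hY.1.le
          gcongr
      _ = (α / 4 * ‖u - y‖ ^ 2 * ‖gradY L x y‖) * g := by ring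
      _ ≤ g ^ 2 := (mul_le_mul_of_nonneg_right hα hg0).trans_eq (sq g).symm

theorem regPayoff_zero (L : Euc m → Euc n → ℝ) (y₀ : Euc n) : regPayoff L y₀ 0 = L := by
  funext x y
  simp [regPayoff]

/-! ### Changing the smoothing parameter -/

namespace Smooth

variable {y₀ : Euc n} {β β' : ℝ}

theorem primalFn_regPayoff_anti (hS : Smooth X Y L Lxx Lyx Lyy μ DX DY) (hy₀ : y₀ ∈ Y)
    (hβ' : 0 ≤ β') (hβ : β' ≤ β) {x : Euc m} (hx : x ∈ X) :
    primalFn Y (regPayoff L y₀ β) x ≤ primalFn Y (regPayoff L y₀ β') x := by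
  obtain ⟨u, hu, h, -⟩ := (hS.regularize y₀ (hβ'.trans hβ)).exists_max ⟨y₀, hy₀⟩ hx
  have h1 := (hS.regularize y₀ hβ').le_primalFn hx hu
  rw [h]
  refine le_trans ?_ h1
  have : β' / 2 * ‖u - y₀‖ ^ 2 ≤ β / 2 * ‖u - y₀‖ ^ 2 := by gcongr
  simp only [regPayoff]
  linarith

theorem primalFn_regPayoff_le_add (hS : Smooth X Y L Lxx Lyx Lyy μ DX DY) (hy₀ : y₀ ∈ Y)
    (hβ' : 0 ≤ β') (hβ : β' ≤ β) {x : Euc m} (hx : x ∈ X) :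
    primalFn Y (regPayoff L y₀ β') x ≤
      primalFn Y (regPayoff L y₀ β) x + (β - β') / 2 * DY ^ 2 := by
  obtain ⟨u, hu, h, -⟩ := (hS.regularize y₀ hβ').exists_max ⟨y₀, hy₀⟩ hx
  have h1 := (hS.regularize y₀ (hβ'.trans hβ)).le_primalFn hx hu
  have h2 := hS.norm_sub_le_diamY hu hy₀
  have h3 := sub_nonneg.2 hβ
  have : (β - β') / 2 * ‖u - y₀‖ ^ 2 ≤ (β - β') / 2 * DY ^ 2 := by gcongr
  rw [h]
  simp only [regPayoff] at h1 ⊢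
  linarith

theorem gapDual_regPayoff_le_add (hS : Smooth X Y L Lxx Lyx Lyy μ DX DY) (hy₀ : y₀ ∈ Y)
    (hβ' : 0 ≤ β') (hβ : β' ≤ β) {x : Euc m} {y : Euc n} (hx : x ∈ X) :
    gapDual Y (regPayoff L y₀ β') x y ≤
      gapDual Y (regPayoff L y₀ β) x y + (β - β') / 2 * DY ^ 2 := by
  have h := hS.primalFn_regPayoff_le_add hy₀ hβ' hβ hx
  have : β' / 2 * ‖y - y₀‖ ^ 2 ≤ β / 2 * ‖y - y₀‖ ^ 2 := by gcongr
  rw [gapDual_eq, gapDual_eq]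
  simp only [regPayoff] at h ⊢
  linarith

end Smooth

end Steps

/-! ### Recursions for real sequences -/

section Numerics

theorem rpow_neg_mul_le {N p : ℝ} (hN : 0 < N) (hp1 : p ≤ 1) :
    N ^ (-p) * (N / (N + 1)) ≤ (N + 1) ^ (-p) := by
  have h1 : N / (N + 1) ≤ (N / (N + 1)) ^ p := by
    have := Real.rpow_le_rpow_of_exponent_ge (x := N / (N + 1)) (by positivity)
      ((div_le_one (by positivity)).2 (by linarith)) hp1
    rwa [Real.rpow_one] at this
  calc N ^ (-p) * (N / (N + 1)) ≤ N ^ (-p) * (N / (N + 1)) ^ p := by gcongr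
    _ = (N + 1) ^ (-p) := by
      rw [Real.div_rpow hN.le (by positivity), Real.rpow_neg hN.le, Real.rpow_neg (by positivity)]
      have := (Real.rpow_pos_of_pos hN p).ne'
      field_simp

theorem half_rpow_neg_le {N p : ℝ} (hN : 1 ≤ N) (hp1 : p ≤ 1) :
    N ^ (-p) / 2 ≤ (N + 1) ^ (-p) := by
  refine le_trans ?_ (rpow_neg_mul_le (by linarith) hp1)
  rw [div_eq_mul_one_div]
  gcongr ?_ * ?_
  rw [div_le_div_iff₀ (by norm_num) (by linarith)]
  linarith

theorem rpow_neg_sub_le {N p : ℝ} (hN : 1 ≤ N) (hp1 : p ≤ 1) :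
    N ^ (-p) - (N + 1) ^ (-p) ≤ N ^ (-(p + 1)) := by
  have hN0 : 0 < N := by linarith
  have h := rpow_neg_mul_le hN0 hp1
  have h1 : N ^ (-(p + 1)) = N ^ (-p) * N⁻¹ := by
    rw [neg_add, Real.rpow_add hN0, Real.rpow_neg_one]
  have h2 : 1 - N⁻¹ ≤ N / (N + 1) := by
    rw [le_div_iff₀ (by linarith)]
    have : N * N⁻¹ = 1 := mul_inv_cancel₀ hN0.ne'
    nlinarith [inv_pos.2 hN0]
  have h3 := mul_le_mul_of_nonneg_left h2 (Real.rpow_nonneg hN0.le (-p))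
  rw [h1]
  linarith

/-- Decay rate of a nonnegative sequence with a superlinear decrease and small perturbations. -/
theorem exists_forall_le_mul_rpow_neg {p r c A B q e Q : ℝ} (hp1 : p ≤ 1)
    (hr : 1 < r) (hc : 0 < c) (hA : 0 ≤ A) (hB : 0 ≤ B) (hQ : Q = p * r + q) (hpQ : p ≤ Q)
    (hQp : Q ≤ p + 1) (he : e + p / 2 = Q) :
    ∃ M : ℝ, 0 < M ∧ ∀ h : ℕ → ℝ, (∀ t, 1 ≤ t → 0 ≤ h t) → h 1 ≤ B →
      (∀ t : ℕ, 1 ≤ t → h (t + 1) ≤ h t - c * ((t : ℝ) + 1) ^ (-q) * h t ^ r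
        + A * ((t : ℝ) + 1) ^ (-e) * √(h t) + A * ((t : ℝ) + 1) ^ (-Q)) →
      ∀ t : ℕ, 1 ≤ t → h t ≤ M * ((t : ℝ) + 1) ^ (-p) := by
  set R : ℝ := (8 / c) ^ (1 / (r - 1))
  have hR : 0 < R := Real.rpow_pos_of_pos (by positivity) _
  -- `2 * B` handles the first index, where `2 ^ (-p) ≥ 1 / 2`; `64 * A ^ 2` makes the perturbations
  -- at most `M / 4`; `4 * R` makes the decrease at level `M / 4` at least `2 * M`. All are chosen
  -- before the sequence.
  set M : ℝ := 1 + 2 * B + 64 * A ^ 2 + 4 * R with hM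
  have hA2 := sq_nonneg A
  have hM1 : 1 ≤ M := by linarith
  have hM0 : 0 < M := by linarith
  have hsM : 8 * A ≤ √M := Real.le_sqrt_of_sq_le (by nlinarith)
  have hsM1 : 1 ≤ √M := Real.one_le_sqrt.2 hM1
  have hsq : √M * √M = M := Real.mul_self_sqrt hM0.le
  have hAM : A * √M + A ≤ M / 4 := by nlinarith
  have hcM : 2 * M ≤ c * (M / 4) ^ r := by
    have h1 : R ≤ M / 4 := by linarith
    have h2 : 8 / c ≤ (M / 4) ^ (r - 1) := by
      have h3 : R ^ (r - 1) = 8 / c := by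
        rw [← Real.rpow_mul (by positivity), one_div_mul_cancel (by linarith), Real.rpow_one]
      rw [← h3]
      exact Real.rpow_le_rpow hR.le h1 (by linarith)
    have h4 : (M / 4) ^ r = (M / 4) ^ (r - 1) * (M / 4) := by
      rw [← Real.rpow_add_one (by positivity), sub_add_cancel]
    rw [h4]
    rw [div_le_iff₀ hc] at h2
    nlinarith
  refine ⟨M, hM0, fun h hpos h1 hrec t ht => ?_⟩
  induction t, ht using Nat.le_induction with
  | base =>
    have h2 := half_rpow_neg_le (N := 1) le_rfl hp1
    rw [Real.one_rpow] at h2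
    have h3 := mul_le_mul_of_nonneg_left h2 hM0.le
    have h4 : B ≤ M * (1 / 2) := by linarith
    push_cast
    exact h1.trans (h4.trans h3)
  | succ t ht ih =>
    have hN : (1 : ℝ) ≤ (t : ℝ) + 1 := by linarith [(Nat.cast_nonneg t : (0 : ℝ) ≤ t)]
    have hrec' := hrec t ht
    push_cast
    set N : ℝ := (t : ℝ) + 1
    have hN0 : 0 < N := by linarith
    have hht := hpos t ht
    have hw := Real.rpow_pos_of_pos hN0 (-p)
    have hsqrt : √(h t) ≤ √M * N ^ (-(p / 2)) := by
      refine Real.sqrt_le_iff.2 ⟨by positivity, ih.trans_eq ?_⟩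
      rw [mul_pow, Real.sq_sqrt hM0.le, ← Real.rpow_natCast, ← Real.rpow_mul hN0.le]
      norm_num
    have hpert : A * N ^ (-e) * √(h t) + A * N ^ (-Q) ≤ (A * √M + A) * N ^ (-Q) := by
      have h2 : A * N ^ (-e) * √(h t) ≤ A * N ^ (-e) * (√M * N ^ (-(p / 2))) := by gcongr
      have h3 : N ^ (-Q) = N ^ (-e) * N ^ (-(p / 2)) := by
        rw [← Real.rpow_add hN0]; congr 1; linarith
      rw [h3] at *
      linarith
    have hQN : N ^ (-Q) ≤ N ^ (-p) := Real.rpow_le_rpow_of_exponent_le hN (by linarith)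
    have hQN' : N ^ (-(p + 1)) ≤ N ^ (-Q) := Real.rpow_le_rpow_of_exponent_le hN (by linarith)
    have hQ0 := Real.rpow_pos_of_pos hN0 (-Q)
    -- Below a quarter of the target the decrease can be ignored: gap and perturbation together stay
    -- under half the target. Above it, the decrease pays for both the perturbation and the drop of
    -- the target from `N` to `N + 1`.
    rcases le_total (h t) (M / 4 * N ^ (-p)) with hcase | hcase
    · have h2 := half_rpow_neg_le hN hp1
      have h3 : 0 ≤ c * N ^ (-q) * h t ^ r := by positivity
      have h4 : (A * √M + A) * N ^ (-Q) ≤ M / 4 * N ^ (-p) := by gcongr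
      have h5 := mul_le_mul_of_nonneg_left h2 hM0.le
      linarith
    · have h2 := rpow_neg_sub_le hN hp1
      have h3 : 2 * M * N ^ (-Q) ≤ c * N ^ (-q) * h t ^ r := by
        calc 2 * M * N ^ (-Q) ≤ c * (M / 4) ^ r * N ^ (-Q) := by gcongr
          _ = c * N ^ (-q) * (M / 4 * N ^ (-p)) ^ r := by
            rw [Real.mul_rpow (by positivity) hw.le, ← Real.rpow_mul hN0.le]
            have : N ^ (-Q) = N ^ (-q) * N ^ (-p * r) := by
              rw [← Real.rpow_add hN0]; congr 1; rw [hQ]; ring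
            rw [this]; ring
          _ ≤ c * N ^ (-q) * h t ^ r := by gcongr
      have h4 : (A * √M + A) * N ^ (-Q) ≤ M * N ^ (-Q) := by gcongr; linarith
      have h5 := mul_le_mul_of_nonneg_left (h2.trans hQN') hM0.le
      linarith

/-- Decay rate of weighted averages. -/
theorem le_mul_rpow_neg_of_average {a A : ℝ} (ha1 : a ≤ 1 / 2) (hA : 0 ≤ A)
    {e : ℕ → ℝ} (he : ∀ t : ℕ, ((t : ℝ) + 1) * e (t + 1) ≤ t * e t + A * ((t : ℝ) + 1) ^ (-a))
    {t : ℕ} (ht : 1 ≤ t) : e t ≤ 2 * A * (t : ℝ) ^ (-a) := by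
  have key : ∀ t : ℕ, t * e t ≤ 2 * A * (t : ℝ) ^ (1 - a) := by
    intro t
    induction t with
    -- The weight `t` vanishes here, so the initial value `e 0` never enters the bound.
    | zero => simp; positivity
    | succ t ih =>
      have h := he t
      push_cast
      have ht0 : (0 : ℝ) ≤ t := Nat.cast_nonneg t
      set s : ℝ := (t : ℝ)
      have hN0 : 0 < s + 1 := by linarith
      have h1 : (s + 1) ^ (1 - a) = (s + 1) ^ (-a) * (s + 1) := by
        rw [← Real.rpow_add_one hN0.ne']; congr 1; ring
      -- The telescoping increment. Since `1 - a ≥ 1 / 2`, it reduces to the bound of `√(1 - 1 / N)`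
      -- by `1 - 1 / (2 * N)`, where `N = s + 1`.
      have h2 : s ^ (1 - a) ≤ (s + 1) ^ (1 - a) - (s + 1) ^ (-a) / 2 := by
        have hdiv : s / (s + 1) ≤ 1 := (div_le_one hN0).2 (by linarith)
        have h3 : (s / (s + 1)) ^ (1 - a) ≤ 1 - 1 / (2 * (s + 1)) := by
          have h4 : (s / (s + 1)) ^ (1 - a) ≤ (s / (s + 1)) ^ (1 / 2 : ℝ) := by
            rcases ht0.eq_or_lt with h0 | h0
            · rw [← h0, zero_div, Real.zero_rpow (by linarith), Real.zero_rpow (by norm_num)]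
            · exact Real.rpow_le_rpow_of_exponent_ge (by positivity) hdiv (by linarith)
          refine h4.trans ?_
          rw [← Real.sqrt_eq_rpow]
          have h6 : 1 / (2 * (s + 1)) ≤ 1 := (div_le_one (by linarith)).2 (by linarith)
          refine Real.sqrt_le_iff.2 ⟨by linarith, ?_⟩
          have h5 : s / (s + 1) = 1 - 2 * (1 / (2 * (s + 1))) := by field_simp; ring
          rw [h5]
          nlinarith [sq_nonneg (1 / (2 * (s + 1)))]
        have h5 : s ^ (1 - a) = (s + 1) ^ (1 - a) * (s / (s + 1)) ^ (1 - a) := by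
          rw [← Real.mul_rpow hN0.le (by positivity), mul_div_cancel₀ _ hN0.ne']
        have h6 := mul_le_mul_of_nonneg_left h3 (Real.rpow_nonneg hN0.le (1 - a))
        have h7 : (s + 1) ^ (1 - a) * (1 - 1 / (2 * (s + 1)))
            = (s + 1) ^ (1 - a) - (s + 1) ^ (-a) / 2 := by
          rw [h1]; field_simp
        linarith
      have h3 := mul_le_mul_of_nonneg_left h2 hA
      linarith
  have ht0 : (0 : ℝ) < t := Nat.cast_pos.2 ht
  have h := key t
  have h1 : (t : ℝ) ^ (1 - a) = (t : ℝ) ^ (-a) * t := by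
    rw [← Real.rpow_add_one ht0.ne']; congr 1; ring
  rw [h1] at h
  refine le_of_mul_le_mul_left ?_ ht0
  linarith

theorem le_sqrt_add_of_sq_le {d P S : ℝ} (hS : 0 ≤ S) (hP : 0 ≤ P)
    (h : d ^ 2 ≤ P + S * d) : d ≤ √P + S := by
  by_contra! hcon
  have h1 := Real.sqrt_nonneg P
  nlinarith [Real.sq_sqrt hP]

/-- The unknown distance `d` also occurs in the drift on the right, so the hypothesis is a quadratic
inequality in `d`; solving it yields a square root part and a linear part. -/
theorem le_of_mul_sq_le_drift {N s b κ g d : ℝ} (hN : 0 < N) (hs : 0 < s) (hκ : 0 ≤ κ)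
    (hg : 0 ≤ g) (h : s * N ^ (-b) / 4 * d ^ 2 ≤ g + κ * N⁻¹ * d) :
    d ≤ 2 / √s * N ^ (b / 2) * √g + 4 * κ / s * N ^ (b - 1) := by
  have hNb := Real.rpow_pos_of_pos hN b
  have h1 : d ^ 2 ≤ (2 / √s * N ^ (b / 2) * √g) ^ 2 + (4 * κ / s * N ^ (b - 1)) * d := by
    have h2 : (2 / √s * N ^ (b / 2) * √g) ^ 2 = 4 / s * N ^ b * g := by
      rw [mul_pow, mul_pow, div_pow, Real.sq_sqrt hs.le, Real.sq_sqrt hg, ← Real.rpow_natCast,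
        ← Real.rpow_natCast, ← Real.rpow_mul hN.le]
      norm_num
    rw [Real.rpow_neg hN.le] at h
    have h3 := mul_le_mul_of_nonneg_left h (by positivity : 0 ≤ 4 / s * N ^ b)
    have h4 : 4 / s * N ^ b * (s * (N ^ b)⁻¹ / 4 * d ^ 2) = d ^ 2 := by field_simp
    rw [h2, Real.rpow_sub_one hN.ne']
    rw [h4] at h3
    refine h3.trans_eq ?_
    field_simp
  have h2 := le_sqrt_add_of_sq_le (by positivity) (sq_nonneg _) h1
  rwa [Real.sqrt_sq (by positivity)] at h2

end Numerics

/-! ### Schedules and feasibility of the iterates -/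

section Trajectory

theorem stepSize_one (t : ℕ) : stepSize 1 t = ((t : ℝ) + 1)⁻¹ := by
  rw [stepSize, Real.rpow_neg_one]

theorem smoothing_nonneg {C : ℝ} (hC : 0 ≤ C) (b : ℝ) (t : ℕ) : 0 ≤ smoothing C b t := by
  unfold smoothing; positivity

theorem smoothing_le {C b : ℝ} (hC : 0 ≤ C) (hb : 0 ≤ b) (t : ℕ) : smoothing C b t ≤ C := by
  have h1 : ((t : ℝ) + 1) ^ (-b) ≤ 1 := Real.rpow_le_one_of_one_le_of_nonpos
    (by linarith [(Nat.cast_nonneg t : (0 : ℝ) ≤ t)]) (by linarith)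
  exact mul_le_of_le_one_right hC h1

theorem smoothing_succ_le {C b : ℝ} (hC : 0 ≤ C) (hb : 0 ≤ b) (t : ℕ) :
    smoothing C b (t + 1) ≤ smoothing C b t := by
  have h0 : (0 : ℝ) ≤ t := Nat.cast_nonneg t
  unfold smoothing
  refine mul_le_mul_of_nonneg_left ?_ hC
  push_cast
  exact Real.rpow_le_rpow_of_nonpos (by linarith) (by linarith) (by linarith)

theorem smoothing_sub_le {C b : ℝ} (hC : 0 ≤ C) (hb1 : b ≤ 1) (t : ℕ) :
    smoothing C b t - smoothing C b (t + 1) ≤ C * ((t : ℝ) + 1) ^ (-(b + 1)) := by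
  have h0 : (0 : ℝ) ≤ t := Nat.cast_nonneg t
  have h := rpow_neg_sub_le (N := (t : ℝ) + 1) (by linarith) hb1
  have h1 := mul_le_mul_of_nonneg_left h hC
  unfold smoothing
  push_cast
  linarith

variable {m n : ℕ} {X : Set (Euc m)} {Y : Set (Euc n)} {L : Euc m → Euc n → ℝ}
  {Lxx Lyx Lyy μ DX DY : ℝ} {β : ℕ → ℝ} {x : ℕ → Euc m} {y : ℕ → Euc n}

theorem IsLMOLMO.exists_dual_oracle
    (hA : IsLMOLMO X Y L Lyy (stepSize 1) β x y) (t : ℕ) :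
    ∃ u γ, IsLMO Y (-gradY (regPayoff L (y 0) (β t)) (x t) (y t)) u ∧
      γ = min (inner ℝ (gradY (regPayoff L (y 0) (β t)) (x t) (y t)) (u - y t) /
        ((Lyy + β t) * ‖u - y t‖ ^ 2)) 1 ∧ y (t + 1) = y t + γ • (u - y t) := by
  obtain ⟨u, hu, h⟩ := (hA.2.2 t).2
  exact ⟨u, _, hu, rfl, h⟩

theorem IsLMOLMO.mem (hS : Smooth X Y L Lxx Lyx Lyy μ DX DY)
    (hA : IsLMOLMO X Y L Lyy (stepSize 1) β x y) (hβ : ∀ t, 0 ≤ β t)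
    (hμ : ∀ t, 0 < μ + β t) (t : ℕ) : x t ∈ X ∧ y t ∈ Y := by
  induction t with
  | zero => exact ⟨hA.1, hA.2.1⟩
  | succ t ih =>
    constructor
    · obtain ⟨v, hv, h⟩ := (hA.2.2 t).1
      have h0 : (0 : ℝ) ≤ t := Nat.cast_nonneg t
      rw [h, stepSize_one]
      exact hS.convex_X.add_smul_sub_mem ih.1 hv.1
        ⟨by positivity, inv_le_one_of_one_le₀ (by linarith)⟩
    · obtain ⟨u, γ, hu, hγ, h⟩ := hA.exists_dual_oracle t
      rw [h]
      exact ((hS.regularize (y 0) (hβ t)).dual_step (hμ t) ih.1 ih.2 hu hγ).1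

end Trajectory

/-! ### From the one-step decrease to rates -/

section Rates

set_option maxHeartbeats 1000000 in
/-- Rates of the LMO-LMO iteration from a decrease of order `r` of the dual gap in the dual step. -/
theorem exists_rate_of_decrease {Lxx Lyx Lyy μ DX DY C s p r k a b : ℝ}
    (P : ∀ n : ℕ, Set (Euc n) → Prop)
    (hLxx : 0 ≤ Lxx) (hLyx : 0 ≤ Lyx) (hLyy : 0 ≤ Lyy) (hDX : 0 ≤ DX) (hDY : 0 ≤ DY)
    (hC : 0 ≤ C) (hs : 0 < s) (hsμ : ∀ t : ℕ, s * ((t : ℝ) + 1) ^ (-b) ≤ μ + smoothing C b t)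
    (hp1 : p ≤ 1) (hr : 1 < r) (hk : 0 ≤ k) (hb0 : 0 ≤ b)
    (ha0 : 0 ≤ a) (ha1 : a ≤ 1 / 2) (hab : a + b ≤ 1) (hapb : 2 * a = p - b)
    (hQ : 1 - b / 2 + p / 2 = p * r + k * b)
    (hCQ : C = 0 ∨ 1 - b / 2 + p / 2 ≤ 1 + b ∧ a ≤ b)
    (hdec : ∀ B, 0 ≤ B → ∃ c, 0 < c ∧ ∀ (m n : ℕ) (X : Set (Euc m)) (Y : Set (Euc n))
      (L : Euc m → Euc n → ℝ) (ℓ ν γ : ℝ) (x : Euc m) (y u : Euc n), P n Y →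
      Smooth X Y L Lxx Lyx ℓ ν DX DY → 0 < ν → ν ≤ μ + C → ℓ ≤ Lyy + C → x ∈ X → y ∈ Y →
      IsLMO Y (-gradY L x y) u →
      γ = min (inner ℝ (gradY L x y) (u - y) / (ℓ * ‖u - y‖ ^ 2)) 1 →
      gapDual Y L x y ≤ B →
      gapDual Y L x (y + γ • (u - y)) ≤
        gapDual Y L x y - c * ν ^ k * gapDual Y L x y ^ r) :
    ∃ K : ℝ, 0 < K ∧ ∀ (m n : ℕ) (X : Set (Euc m)) (Y : Set (Euc n))
      (L : Euc m → Euc n → ℝ) (x : ℕ → Euc m) (y : ℕ → Euc n),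
      Smooth X Y L Lxx Lyx Lyy μ DX DY → ConvexConcave X Y L → P n Y →
      IsLMOLMO X Y L Lyy (stepSize 1) (smoothing C b) x y → ∀ T : ℕ, 1 ≤ T →
      gapOpt X Y L (x T) ≤ K * ((T : ℝ) ^ (-a) + C * (T : ℝ) ^ (-b)) ∧
      gapDual Y L (x T) (y T) ≤ K * ((T : ℝ) ^ (-p) + C * (T : ℝ) ^ (-b)) := by
  set κ := Lyx * DX with hκdef
  have hκ : 0 ≤ κ := by positivity
  have hb1 : b ≤ 1 := by linarith
  -- Bounds the gap from time `1` on: the uniform bound after a dual step, plus the drift in `x` and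
  -- in `β`. The gap at time `0` is not controlled by the constants, which is why the recursion
  -- starts at `1`.
  set B := (Lyy + C) * DY ^ 2 + κ * DY + C * DY ^ 2 / 2 with hBdef
  have hB : 0 ≤ B := by positivity
  obtain ⟨c, hc, hdecr⟩ := hdec B hB
  set A := κ * (2 / √s) + 4 * κ ^ 2 / s + C * DY ^ 2 / 2 with hAdef
  have hA0 : 0 ≤ A := by positivity
  obtain ⟨M, hM, hrate⟩ := exists_forall_le_mul_rpow_neg (p := p) (r := r) (c := c * s ^ k)
    (A := A) (B := B) (q := k * b) (e := 1 - b / 2) (Q := 1 - b / 2 + p / 2) hp1 hr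
    (by positivity) hA0 hB hQ (by linarith) (by linarith) rfl
  -- The summand `DY` covers time `0`, where the decay of the gap is not yet available.
  set R := 2 / √s * √M + 4 * κ / s + DY with hRdef
  have hR : 0 ≤ R := by positivity
  set A₂ := 2 * κ * R + Lxx / 2 * DX ^ 2 + C * DY ^ 2 / 2 with hA₂def
  have hA₂ : 0 ≤ A₂ := by positivity
  refine ⟨2 * A₂ + M + DY ^ 2 / 2, by positivity, ?_⟩
  intro m n X Y L x y hS hcc hP halg
  set β := smoothing C b with hβdef
  have hβ0 : ∀ t, 0 ≤ β t := smoothing_nonneg hC b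
  have hβC : ∀ t, β t ≤ C := smoothing_le hC hb0
  have hβs : ∀ t, β (t + 1) ≤ β t := smoothing_succ_le hC hb0
  have hN1 : ∀ t : ℕ, (1 : ℝ) ≤ (t : ℝ) + 1 := fun t => by
    linarith [(Nat.cast_nonneg t : (0 : ℝ) ≤ t)]
  have hN0 : ∀ t : ℕ, (0 : ℝ) < (t : ℝ) + 1 := fun t => by linarith [hN1 t]
  have hμ : ∀ t, 0 < μ + β t := fun t =>
    (mul_pos hs (Real.rpow_pos_of_pos (hN0 t) _)).trans_le (hsμ t)
  have hmem := halg.mem hS hβ0 hμ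
  have hy0 := (hmem 0).2
  have hSt := fun t => hS.regularize (y 0) (hβ0 t)
  set h : ℕ → ℝ := fun t => gapDual Y (regPayoff L (y 0) (β t)) (x t) (y t) with hh
  have hhpos : ∀ t, 0 ≤ h t := fun t => (hSt t).gapDual_nonneg (hmem t).1 (hmem t).2
  have hδ : ∀ t : ℕ, (β t - β (t + 1)) / 2 * DY ^ 2
      ≤ C * DY ^ 2 / 2 * ((t : ℝ) + 1) ^ (-(b + 1)) := fun t => by
    have h1 := mul_le_mul_of_nonneg_right (smoothing_sub_le hC hb1 t) (sq_nonneg DY)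
    linarith
  have hstep : ∀ t, ∃ g d, 0 ≤ g ∧ 0 ≤ d ∧ d ≤ DY ∧ g ≤ (Lyy + C) * DY ^ 2 ∧ g ≤ h t ∧
      (h t ≤ B → g ≤ h t - c * (μ + β t) ^ k * h t ^ r) ∧
      s * ((t : ℝ) + 1) ^ (-b) / 4 * d ^ 2 ≤ g + κ * ((t : ℝ) + 1)⁻¹ * d ∧
      h (t + 1) ≤ g + κ * ((t : ℝ) + 1)⁻¹ * d
        + C * DY ^ 2 / 2 * ((t : ℝ) + 1) ^ (-(b + 1)) := by
    intro t
    obtain ⟨u, γ, hu, hγ, hyt⟩ := halg.exists_dual_oracle t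
    obtain ⟨-, -, h1, h2, -⟩ := (hSt t).dual_step (hμ t) (hmem t).1 (hmem t).2 hu hγ
    rw [← hyt] at h1 h2
    obtain ⟨d, hd0, hd1, hd2, hd3⟩ := (hSt t).exists_gapDual_le_add (hmem t).1 (hmem (t + 1)).1
      (hmem (t + 1)).2
    have hxx : ‖x (t + 1) - x t‖ ≤ ((t : ℝ) + 1)⁻¹ * DX := by
      obtain ⟨v, hv, hx⟩ := (halg.2.2 t).1
      rw [hx, add_sub_cancel_left, norm_smul, stepSize_one, norm_inv,
        Real.norm_of_nonneg (hN0 t).le]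
      exact mul_le_mul_of_nonneg_left (hS.norm_sub_le_diamX hv.1 (hmem t).1)
        (inv_nonneg.2 (hN0 t).le)
    have hxd : Lyx * ‖x (t + 1) - x t‖ * d ≤ κ * ((t : ℝ) + 1)⁻¹ * d := by
      have h3 : Lyx * ‖x (t + 1) - x t‖ * d ≤ Lyx * (((t : ℝ) + 1)⁻¹ * DX) * d := by gcongr
      refine h3.trans_eq ?_
      rw [hκdef]; ring
    refine ⟨gapDual Y (regPayoff L (y 0) (β t)) (x t) (y (t + 1)), d,
      (hSt t).gapDual_nonneg (hmem t).1 (hmem (t + 1)).2, hd0, hd1, ?_, h2, ?_, ?_, ?_⟩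
    · exact h1.trans (by gcongr; exact hβC t)
    · intro hhB
      have h3 := hdecr m n X Y _ _ _ γ _ _ u hP (hSt t) (hμ t) (by gcongr; exact hβC t)
        (by gcongr; exact hβC t) (hmem t).1 (hmem t).2 hu hγ hhB
      rwa [← hyt] at h3
    · have h3 : s * ((t : ℝ) + 1) ^ (-b) / 4 * d ^ 2 ≤ (μ + β t) / 4 * d ^ 2 := by
        gcongr; exact hsμ t
      linarith
    · have h3 := hS.gapDual_regPayoff_le_add (y := y (t + 1)) hy0 (hβ0 (t + 1)) (hβs t)
        (hmem (t + 1)).1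
      have h4 := hδ t
      simp only [hh]
      linarith
  have hhB : ∀ t, 1 ≤ t → h t ≤ B := by
    intro t ht
    obtain ⟨t, rfl⟩ := Nat.exists_eq_add_of_le' ht
    obtain ⟨g, d, -, hd0, hd1, hg, -, -, -, hnext⟩ := hstep t
    have h1 : ((t : ℝ) + 1) ^ (-(b + 1)) ≤ 1 :=
      Real.rpow_le_one_of_one_le_of_nonpos (hN1 t) (by linarith)
    have h2 : ((t : ℝ) + 1)⁻¹ ≤ 1 := inv_le_one_of_one_le₀ (hN1 t)
    have h3 : κ * ((t : ℝ) + 1)⁻¹ * d ≤ κ * 1 * DY := by gcongr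
    have h4 : C * DY ^ 2 / 2 * ((t : ℝ) + 1) ^ (-(b + 1)) ≤ C * DY ^ 2 / 2 * 1 := by gcongr
    linarith
  have hCpow : ∀ (N E F : ℝ), 1 ≤ N → (C = 0 ∨ F ≤ E) →
      C * DY ^ 2 / 2 * N ^ (-E) ≤ C * DY ^ 2 / 2 * N ^ (-F) := by
    rintro N E F hN (h0 | hEF)
    · simp [h0]
    · have := Real.rpow_le_rpow_of_exponent_le hN (neg_le_neg hEF)
      gcongr
  have hhM : ∀ t : ℕ, 1 ≤ t → h t ≤ M * ((t : ℝ) + 1) ^ (-p) := by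
    refine hrate h (fun t _ => hhpos t) (hhB 1 le_rfl) fun t ht => ?_
    obtain ⟨g, d, hg0, hd0, -, -, hgh, hg, hd, hnext⟩ := hstep t
    have hN := hN0 t
    have hNN := hN1 t
    have hdrift := le_of_mul_sq_le_drift hN hs hκ hg0 hd
    have hht := hhpos t
    have hσ := hsμ t
    have h1 := hg (hhB t ht)
    -- The drift in `β` has order `N ^ (-(b + 1))` and is absorbed into the perturbation of order `N
    -- ^ (-Q)`; for `C = 0` it is absent.
    have h4 := hCpow _ _ _ hNN (hCQ.imp_right fun H => H.1.trans_eq (add_comm 1 b))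
    set N := (t : ℝ) + 1
    have h2 : c * s ^ k * N ^ (-(k * b)) * h t ^ r ≤ c * (μ + β t) ^ k * h t ^ r := by
      have : s ^ k * N ^ (-(k * b)) ≤ (μ + β t) ^ k := by
        refine le_trans (Eq.le ?_) (Real.rpow_le_rpow (by positivity) hσ hk)
        rw [Real.mul_rpow hs.le (by positivity), ← Real.rpow_mul hN.le]
        congr 2; ring
      rw [mul_assoc c]
      gcongr
    have h3 : κ * N⁻¹ * d ≤ κ * (2 / √s) * N ^ (-(1 - b / 2)) * √(h t)
        + 4 * κ ^ 2 / s * N ^ (-(1 - b / 2 + p / 2)) := by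
      have e1 : N⁻¹ * N ^ (b / 2) = N ^ (-(1 - b / 2)) := by
        rw [← Real.rpow_neg_one, ← Real.rpow_add hN]; congr 1; ring
      have e2 : N⁻¹ * N ^ (b - 1) ≤ N ^ (-(1 - b / 2 + p / 2)) := by
        rw [← Real.rpow_neg_one, ← Real.rpow_add hN]
        exact Real.rpow_le_rpow_of_exponent_le hNN (by linarith)
      calc κ * N⁻¹ * d ≤ κ * N⁻¹ * (2 / √s * N ^ (b / 2) * √g + 4 * κ / s * N ^ (b - 1)) := by
            gcongr
        _ = κ * (2 / √s) * (N⁻¹ * N ^ (b / 2)) * √g + 4 * κ ^ 2 / s * (N⁻¹ * N ^ (b - 1)) := by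
            ring
        _ ≤ κ * (2 / √s) * N ^ (-(1 - b / 2)) * √(h t)
            + 4 * κ ^ 2 / s * N ^ (-(1 - b / 2 + p / 2)) := by
            rw [e1]; gcongr
    have h5 : 0 ≤ (4 * κ ^ 2 / s + C * DY ^ 2 / 2) * (N ^ (-(1 - b / 2)) * √(h t)) := by
      positivity
    have h6 : 0 ≤ κ * (2 / √s) * N ^ (-(1 - b / 2 + p / 2)) := by positivity
    rw [hAdef]
    linarith
  intro T hT
  have hT1 : (1 : ℝ) ≤ T := by exact_mod_cast hT
  have hT0 : (0 : ℝ) < T := by linarith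
  have hanti : ∀ q : ℝ, 0 ≤ q → ((T : ℝ) + 1) ^ (-q) ≤ (T : ℝ) ^ (-q) := fun q hq =>
    Real.rpow_le_rpow_of_nonpos hT0 (by linarith) (by linarith)
  have hβT : β T ≤ C * (T : ℝ) ^ (-b) := mul_le_mul_of_nonneg_left (hanti b hb0) hC
  have hβTD : (β T - 0) / 2 * DY ^ 2 ≤ DY ^ 2 / 2 * (C * (T : ℝ) ^ (-b)) := by
    have := mul_le_mul_of_nonneg_right hβT (sq_nonneg DY)
    linarith
  have hCT : 0 ≤ C * (T : ℝ) ^ (-b) := by positivity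
  constructor
  · have hopt : ∀ w ∈ X, primalFn Y L (x T) - primalFn Y L w
        ≤ (2 * A₂ + M + DY ^ 2 / 2) * ((T : ℝ) ^ (-a) + C * (T : ℝ) ^ (-b)) := by
      intro w hw
      -- The regularized value at the iterate is compared with the unregularized value at `w`. This
      -- is legitimate because the penalty only lowers values, so the bias is paid once, at time
      -- `T`.
      have havg := le_mul_rpow_neg_of_average ha1 hA₂
        (e := fun t => primalFn Y (regPayoff L (y 0) (β t)) (x t) - primalFn Y L w) ?_ hT
      · have h1 := hS.primalFn_regPayoff_le_add hy0 le_rfl (hβ0 T) (hmem T).1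
        rw [regPayoff_zero] at h1
        have h2 : 0 ≤ M * (T : ℝ) ^ (-a) := by positivity
        have h3 : 0 ≤ DY ^ 2 / 2 * (T : ℝ) ^ (-a) := by positivity
        have h4 : 0 ≤ (2 * A₂ + M) * (C * (T : ℝ) ^ (-b)) := by positivity
        linarith
      · intro t
        obtain ⟨v, hv, hx⟩ := (halg.2.2 t).1
        rw [stepSize_one] at hx
        have hN := hN0 t
        have hNN := hN1 t
        obtain ⟨d, hd0, hd1, hd2, hd3⟩ := (hSt t).exists_primalFn_step_le
          (fun y' hy' => hcc.regularize_convexOn (y 0) (β t) hy') (hmem t).1 hw (hmem t).2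
          (by rwa [gradX_regPayoff]) (inv_nonneg.2 hN.le) (inv_le_one_of_one_le₀ hNN)
        rw [← hx] at hd3
        have hw' := hS.primalFn_regPayoff_anti hy0 le_rfl (hβ0 t) hw
        rw [regPayoff_zero] at hw'
        have hnext := hS.primalFn_regPayoff_le_add hy0 (hβ0 (t + 1)) (hβs t) (hmem (t + 1)).1
        have hδt := hδ t
        have hdR : d ≤ R * ((t : ℝ) + 1) ^ (-a) := by
          rcases Nat.eq_zero_or_pos t with rfl | ht
          · have : 0 ≤ 2 / √s * √M + 4 * κ / s := by positivity
            simp only [Nat.cast_zero, zero_add, Real.one_rpow, mul_one]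
            linarith
          · have h1 := le_of_mul_sq_le_drift hN hs hκ (hhpos t) (d := d) (b := b) (by
              have h3 : s * ((t : ℝ) + 1) ^ (-b) / 4 * d ^ 2 ≤ (μ + β t) / 4 * d ^ 2 := by
                gcongr; exact hsμ t
              exact h3.trans hd2)
            have h2 := hhM t ht
            set N := (t : ℝ) + 1
            have h3 : √(h t) ≤ √M * N ^ (-(p / 2)) := by
              refine Real.sqrt_le_iff.2 ⟨by positivity, h2.trans_eq ?_⟩
              rw [mul_pow, Real.sq_sqrt hM.le, ← Real.rpow_natCast, ← Real.rpow_mul hN.le]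
              norm_num
            have h4 : N ^ (b / 2) * N ^ (-(p / 2)) = N ^ (-a) := by
              rw [← Real.rpow_add hN]; congr 1; linarith
            have h5 : N ^ (b - 1) ≤ N ^ (-a) :=
              Real.rpow_le_rpow_of_exponent_le hNN (by linarith)
            calc d ≤ _ := h1
              _ ≤ 2 / √s * N ^ (b / 2) * (√M * N ^ (-(p / 2))) + 4 * κ / s * N ^ (-a) := by
                  gcongr
              _ = (2 / √s * √M + 4 * κ / s) * N ^ (-a) := by rw [← h4]; ring
              _ ≤ R * N ^ (-a) := by gcongr; linarith
        have hCa := hCpow _ _ _ hNN (hCQ.imp_right fun H => H.2)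
        set N := (t : ℝ) + 1 with hNdef
        have hpow : N * N ^ (-(b + 1)) = N ^ (-b) := by
          rw [mul_comm, ← Real.rpow_add_one hN.ne']; congr 1; ring
        have hinv : N⁻¹ ≤ N ^ (-a) := by
          rw [← Real.rpow_neg_one]
          exact Real.rpow_le_rpow_of_exponent_le hNN (by linarith)
        have ht : (t : ℝ) = N - 1 := by rw [hNdef]; ring
        set pt := primalFn Y (regPayoff L (y 0) (β t)) (x t)
        have h1 : primalFn Y (regPayoff L (y 0) (β (t + 1))) (x (t + 1)) ≤
            (1 - N⁻¹) * pt + N⁻¹ * primalFn Y L w + 2 * N⁻¹ * κ * d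
              + Lxx / 2 * N⁻¹ ^ 2 * DX ^ 2 + C * DY ^ 2 / 2 * N ^ (-(b + 1)) := by
          have h2 := mul_le_mul_of_nonneg_left hw' (inv_nonneg.2 hN.le)
          linarith
        have h2 := mul_le_mul_of_nonneg_left h1 hN.le
        have h3 : N * ((1 - N⁻¹) * pt + N⁻¹ * primalFn Y L w + 2 * N⁻¹ * κ * d
              + Lxx / 2 * N⁻¹ ^ 2 * DX ^ 2 + C * DY ^ 2 / 2 * N ^ (-(b + 1)))
            = (N - 1) * pt + primalFn Y L w + 2 * κ * d + Lxx / 2 * DX ^ 2 * N⁻¹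
              + C * DY ^ 2 / 2 * N ^ (-b) := by
          rw [← hpow]; field_simp
        rw [h3] at h2
        have h4 : 2 * κ * d ≤ 2 * κ * (R * N ^ (-a)) := by gcongr
        have h5 : Lxx / 2 * DX ^ 2 * N⁻¹ ≤ Lxx / 2 * DX ^ 2 * N ^ (-a) := by gcongr
        rw [ht, hA₂def]
        linarith
    have hne : (primalFn Y L '' X).Nonempty := ⟨_, x 0, (hmem 0).1, rfl⟩
    have hinf : primalFn Y L (x T) - (2 * A₂ + M + DY ^ 2 / 2) *
        ((T : ℝ) ^ (-a) + C * (T : ℝ) ^ (-b)) ≤ sInf (primalFn Y L '' X) := by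
      refine le_csInf hne ?_
      rintro _ ⟨w, hw, rfl⟩
      linarith [hopt w hw]
    rw [gapOpt]
    linarith
  · have h1 := hS.gapDual_regPayoff_le_add (y := y T) hy0 le_rfl (hβ0 T) (hmem T).1
    rw [regPayoff_zero] at h1
    have h2 := (hhM T hT).trans (mul_le_mul_of_nonneg_left (hanti p (by linarith)) hM.le)
    have h3 : 0 ≤ (2 * A₂ + DY ^ 2 / 2) * (T : ℝ) ^ (-p) := by positivity
    have h4 : 0 ≤ (2 * A₂ + M) * (C * (T : ℝ) ^ (-b)) := by positivity
    simp only [hh] at h2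
    linarith

theorem exists_rate {Lxx Lyx Lyy μ DX DY C s p a b : ℝ}
    (hC : 0 ≤ C) (hs : 0 < s)
    (hsμ : 0 ≤ μ → ∀ t : ℕ, s * ((t : ℝ) + 1) ^ (-b) ≤ μ + smoothing C b t)
    (hp1 : p ≤ 1) (hb0 : 0 ≤ b)
    (ha0 : 0 ≤ a) (ha1 : a ≤ 1 / 2) (hab : a + b ≤ 1) (hapb : 2 * a = p - b)
    (hQ : 1 - b / 2 + p / 2 = p * 2)
    (hCQ : C = 0 ∨ 1 - b / 2 + p / 2 ≤ 1 + b ∧ a ≤ b) :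
    ∃ K : ℝ, 0 < K ∧ ∀ (m n : ℕ) (X : Set (Euc m)) (Y : Set (Euc n))
      (L : Euc m → Euc n → ℝ) (x : ℕ → Euc m) (y : ℕ → Euc n),
      Smooth X Y L Lxx Lyx Lyy μ DX DY → ConvexConcave X Y L →
      IsLMOLMO X Y L Lyy (stepSize 1) (smoothing C b) x y → ∀ T : ℕ, 1 ≤ T →
      gapOpt X Y L (x T) ≤ K * ((T : ℝ) ^ (-a) + C * (T : ℝ) ^ (-b)) ∧
      gapDual Y L (x T) (y T) ≤ K * ((T : ℝ) ^ (-p) + C * (T : ℝ) ^ (-b)) := by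
  -- The constants are arbitrary reals; with a wrong sign there are no admissible data and any `K`
  -- serves.
  by_cases hsign : 0 ≤ Lxx ∧ 0 ≤ Lyx ∧ 0 ≤ Lyy ∧ 0 ≤ DX ∧ 0 ≤ DY ∧ 0 ≤ μ
  swap
  · exact ⟨1, one_pos, fun m n X Y L x y hS => absurd ⟨hS.Lxx_nonneg, hS.Lyx_pos.le,
      hS.Lyy_nonneg, hS.diamX_nonneg, hS.diamY_nonneg, hS.mu_nonneg⟩ hsign⟩
  obtain ⟨hLxx, hLyx, hLyy, hDX, hDY, hμ⟩ := hsign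
  obtain ⟨K, hK, h⟩ := exists_rate_of_decrease (r := 2) (k := 0) (fun _ _ => True) hLxx hLyx hLyy
    hDX hDY hC hs (hsμ hμ) hp1 one_lt_two le_rfl hb0 ha0 ha1 hab hapb (by linarith) hCQ (by
      intro B hB
      refine ⟨1 / (2 * ((Lyy + C) * DY ^ 2 + B + 1)), by positivity, ?_⟩
      intro m n X Y L ℓ ν γ x y u _ hS hν _ hℓ hx hy hu hγ hgap
      have h1 := hS.gapDual_step_le_quadratic hν hx hy hu hγ hℓ hgap
      rwa [Real.rpow_zero, mul_one, Real.rpow_two])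
  exact ⟨K, hK, fun m n X Y L x y hS hc ha => h m n X Y L x y hS hc trivial ha⟩

theorem exists_rate_of_stronglyConvexSet {Lxx Lyx Lyy μ DX DY C s p a b α : ℝ} (hα : 0 < α)
    (hC : 0 ≤ C) (hs : 0 < s)
    (hsμ : 0 ≤ μ → ∀ t : ℕ, s * ((t : ℝ) + 1) ^ (-b) ≤ μ + smoothing C b t)
    (hp1 : p ≤ 1) (hb0 : 0 ≤ b)
    (ha0 : 0 ≤ a) (ha1 : a ≤ 1 / 2) (hab : a + b ≤ 1) (hapb : 2 * a = p - b)
    (hQ : 1 - b / 2 + p / 2 = p * (3 / 2) + 1 / 2 * b)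
    (hCQ : C = 0 ∨ 1 - b / 2 + p / 2 ≤ 1 + b ∧ a ≤ b) :
    ∃ K : ℝ, 0 < K ∧ ∀ (m n : ℕ) (X : Set (Euc m)) (Y : Set (Euc n))
      (L : Euc m → Euc n → ℝ) (x : ℕ → Euc m) (y : ℕ → Euc n),
      Smooth X Y L Lxx Lyx Lyy μ DX DY → ConvexConcave X Y L → StronglyConvexSet α Y →
      IsLMOLMO X Y L Lyy (stepSize 1) (smoothing C b) x y → ∀ T : ℕ, 1 ≤ T →
      gapOpt X Y L (x T) ≤ K * ((T : ℝ) ^ (-a) + C * (T : ℝ) ^ (-b)) ∧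
      gapDual Y L (x T) (y T) ≤ K * ((T : ℝ) ^ (-p) + C * (T : ℝ) ^ (-b)) := by
  by_cases hsign : 0 ≤ Lxx ∧ 0 ≤ Lyx ∧ 0 ≤ Lyy ∧ 0 ≤ DX ∧ 0 ≤ DY ∧ 0 ≤ μ
  swap
  · exact ⟨1, one_pos, fun m n X Y L x y hS => absurd ⟨hS.Lxx_nonneg, hS.Lyx_pos.le,
      hS.Lyy_nonneg, hS.diamX_nonneg, hS.diamY_nonneg, hS.mu_nonneg⟩ hsign⟩
  obtain ⟨hLxx, hLyx, hLyy, hDX, hDY, hμ⟩ := hsign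
  exact exists_rate_of_decrease (r := 3 / 2) (k := 1 / 2) (fun _ Y => StronglyConvexSet α Y)
    hLxx hLyx hLyy hDX hDY hC hs (hsμ hμ) hp1 (by norm_num) (by norm_num) hb0 ha0 ha1 hab hapb
    hQ hCQ (by
      intro B hB
      -- With `c = 1 / W`, the first and last summands meet the two conditions on `c`, uniformly
      -- over `ν ≤ μ + C` and `ℓ ≤ Lyy + C`; the `1` ensures positivity.
      set W := 2 * (√(μ + C) * √B) + 1 + 8 * (Lyy + C) / α with hW
      have hW1 : 0 ≤ √(μ + C) * √B := by positivity
      have hW2 : 0 ≤ 8 * (Lyy + C) / α := by positivity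
      have hW0 : 0 < W := by linarith
      refine ⟨1 / W, by positivity, ?_⟩
      intro m n X Y L ℓ ν γ x y u hY hS hν hν' hℓ hx hy hu hγ hgap
      have h0 := hS.gapDual_nonneg hx hy
      have h1 := hS.gapDual_step_le_of_stronglyConvexSet hν hY hx hy hu hγ (c := 1 / W)
        (by positivity) hgap
        (by
          rw [one_div_mul_eq_div, div_le_iff₀ hW0]
          have : √ν * √B ≤ √(μ + C) * √B := by gcongr
          linarith)
        (by
          have h2 : 8 * (1 / W) * ℓ = 8 * ℓ / W := by ring
          rw [h2, div_le_iff₀ hW0]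
          have h3 : α * (8 * (Lyy + C) / α) ≤ α * W := by gcongr; linarith
          rw [mul_div_cancel₀ _ hα.ne'] at h3
          linarith)
      have h2 : gapDual Y L x y ^ (3 / 2 : ℝ) = gapDual Y L x y * √(gapDual Y L x y) := by
        rw [Real.sqrt_eq_rpow, ← Real.rpow_one_add' h0 (by norm_num)]
        norm_num
      rwa [h2, ← Real.sqrt_eq_rpow])

theorem one_le_sqrt_log_add_two {T : ℕ} (hT : 1 ≤ T) : 1 ≤ √(Real.log ((T : ℝ) + 2)) := by
  have hT1 : (1 : ℝ) ≤ T := by exact_mod_cast hT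
  rw [Real.one_le_sqrt, Real.le_log_iff_exp_le (by linarith)]
  linarith [Real.exp_one_lt_d9]

theorem smoothing_zero_zero : smoothing 0 0 = fun _ => 0 := by
  funext t
  simp [smoothing]

end Rates

end MinimaxLMO

/-! ### Choice of exponents in the four cases -/

theorem theorem2 (Lxx Lyx Lyy μ DX DY : ℝ) :
    -- convex-concave
    (∀ C : ℝ, 0 < C → ∃ K : ℝ, 0 < K ∧
      ∀ (m n : ℕ) (X : Set (MinimaxLMO.Euc m)) (Y : Set (MinimaxLMO.Euc n))
        (L : MinimaxLMO.Euc m → MinimaxLMO.Euc n → ℝ)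
        (x : ℕ → MinimaxLMO.Euc m) (y : ℕ → MinimaxLMO.Euc n),
        MinimaxLMO.Smooth X Y L Lxx Lyx Lyy μ DX DY →
        MinimaxLMO.ConvexConcave X Y L →
        MinimaxLMO.IsLMOLMO X Y L Lyy (MinimaxLMO.stepSize 1)
          (MinimaxLMO.smoothing C (1 / 5)) x y →
        ∀ T : ℕ, 1 ≤ T →
          MinimaxLMO.gapOpt X Y L (x T) ≤ K * (T : ℝ) ^ (-(1 / 5) : ℝ) ∧
          MinimaxLMO.gapDual Y L (x T) (y T) ≤ K * (T : ℝ) ^ (-(1 / 5) : ℝ)) ∧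
    -- convex-strongly concave
    (0 < μ → ∃ K : ℝ, 0 < K ∧
      ∀ (m n : ℕ) (X : Set (MinimaxLMO.Euc m)) (Y : Set (MinimaxLMO.Euc n))
        (L : MinimaxLMO.Euc m → MinimaxLMO.Euc n → ℝ)
        (x : ℕ → MinimaxLMO.Euc m) (y : ℕ → MinimaxLMO.Euc n),
        MinimaxLMO.Smooth X Y L Lxx Lyx Lyy μ DX DY →
        MinimaxLMO.ConvexConcave X Y L →
        MinimaxLMO.IsLMOLMO X Y L Lyy (MinimaxLMO.stepSize 1) (fun _ => 0) x y →
        ∀ T : ℕ, 1 ≤ T →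
          MinimaxLMO.gapOpt X Y L (x T) ≤
            K * √(Real.log ((T : ℝ) + 2)) * (T : ℝ) ^ (-(1 / 3) : ℝ) ∧
          MinimaxLMO.gapDual Y L (x T) (y T) ≤ K * (T : ℝ) ^ (-(2 / 3) : ℝ)) ∧
    -- convex-concave, strongly convex `Y`
    (∀ C α : ℝ, 0 < C → 0 < α → ∃ K : ℝ, 0 < K ∧
      ∀ (m n : ℕ) (X : Set (MinimaxLMO.Euc m)) (Y : Set (MinimaxLMO.Euc n))
        (L : MinimaxLMO.Euc m → MinimaxLMO.Euc n → ℝ)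
        (x : ℕ → MinimaxLMO.Euc m) (y : ℕ → MinimaxLMO.Euc n),
        MinimaxLMO.Smooth X Y L Lxx Lyx Lyy μ DX DY →
        MinimaxLMO.ConvexConcave X Y L →
        MinimaxLMO.StronglyConvexSet α Y →
        MinimaxLMO.IsLMOLMO X Y L Lyy (MinimaxLMO.stepSize 1)
          (MinimaxLMO.smoothing C (1 / 4)) x y →
        ∀ T : ℕ, 1 ≤ T →
          MinimaxLMO.gapOpt X Y L (x T) ≤ K * (T : ℝ) ^ (-(1 / 4) : ℝ) ∧
          MinimaxLMO.gapDual Y L (x T) (y T) ≤ K * (T : ℝ) ^ (-(1 / 4) : ℝ)) ∧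
    -- convex-strongly concave, strongly convex `Y`
    (∀ α : ℝ, 0 < μ → 0 < α → ∃ K : ℝ, 0 < K ∧
      ∀ (m n : ℕ) (X : Set (MinimaxLMO.Euc m)) (Y : Set (MinimaxLMO.Euc n))
        (L : MinimaxLMO.Euc m → MinimaxLMO.Euc n → ℝ)
        (x : ℕ → MinimaxLMO.Euc m) (y : ℕ → MinimaxLMO.Euc n),
        MinimaxLMO.Smooth X Y L Lxx Lyx Lyy μ DX DY →
        MinimaxLMO.ConvexConcave X Y L →
        MinimaxLMO.StronglyConvexSet α Y →
        MinimaxLMO.IsLMOLMO X Y L Lyy (MinimaxLMO.stepSize 1) (fun _ => 0) x y →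
        ∀ T : ℕ, 1 ≤ T →
          MinimaxLMO.gapOpt X Y L (x T) ≤
            K * √(Real.log ((T : ℝ) + 2)) * (T : ℝ) ^ (-(1 / 2) : ℝ) ∧
          MinimaxLMO.gapDual Y L (x T) (y T) ≤ K * (T : ℝ) ^ (-1 : ℝ)) := by
  have hpow : ∀ (T : ℕ) (p q : ℝ), 1 ≤ T → q ≤ p → (T : ℝ) ^ (-p) ≤ (T : ℝ) ^ (-q) :=
    fun T p q hT hpq => Real.rpow_le_rpow_of_exponent_le (by exact_mod_cast hT) (by linarith)
  have hlog : ∀ (T : ℕ) (K q : ℝ), 1 ≤ T → 0 ≤ K →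
      K * (T : ℝ) ^ q ≤ K * √(Real.log ((T : ℝ) + 2)) * (T : ℝ) ^ q := by
    intro T K q hT hK
    have h1 := MinimaxLMO.one_le_sqrt_log_add_two hT
    have h2 : (0 : ℝ) ≤ (T : ℝ) ^ q := by positivity
    exact mul_le_mul_of_nonneg_right (le_mul_of_one_le_right hK h1) h2
  refine ⟨fun C hC => ?_, fun hμ => ?_, fun C α hC hα => ?_, fun α hμ hα => ?_⟩
  -- With `s = C` the smoothing alone supplies the modulus. Balance asks for `1 - b / 2 + p / 2 = 2
  -- * p`, and the drift in `β` for `2 * p ≤ 1 + b`; `b = 1 / 5`, `p = 3 / 5` make both equalities,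
  -- and then `a = b`.
  · obtain ⟨K, hK, h⟩ := MinimaxLMO.exists_rate (Lxx := Lxx) (Lyx := Lyx) (Lyy := Lyy) (μ := μ)
      (DX := DX) (DY := DY) (C := C) (s := C) (p := 3 / 5) (a := 1 / 5) (b := 1 / 5) hC.le hC
      (fun hμ t => le_add_of_nonneg_left hμ) (by norm_num) (by norm_num) (by norm_num)
      (by norm_num) (by norm_num) (by norm_num) (by norm_num) (Or.inr (by norm_num))
    refine ⟨K * (1 + C), by positivity, fun m n X Y L x y hS hc ha T hT => ?_⟩
    obtain ⟨h1, h2⟩ := h m n X Y L x y hS hc ha T hT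
    have h3 := mul_le_mul_of_nonneg_left (hpow T (3 / 5) (1 / 5) hT (by norm_num)) hK.le
    constructor <;> linarith
  -- With `b = 0` and `s = μ` there is no bias, and balance gives `p = 2 / 3`, `a = p / 2`.
  · obtain ⟨K, hK, h⟩ := MinimaxLMO.exists_rate (Lxx := Lxx) (Lyx := Lyx) (Lyy := Lyy) (μ := μ)
      (DX := DX) (DY := DY) (C := 0) (s := μ) (p := 2 / 3) (a := 1 / 3) (b := 0) le_rfl hμ
      (fun _ t => by simp [MinimaxLMO.smoothing]) (by norm_num) (by norm_num) (by norm_num)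
      (by norm_num) (by norm_num) (by norm_num) (by norm_num) (Or.inl rfl)
    refine ⟨K, hK, fun m n X Y L x y hS hc ha T hT => ?_⟩
    rw [← MinimaxLMO.smoothing_zero_zero] at ha
    obtain ⟨h1, h2⟩ := h m n X Y L x y hS hc ha T hT
    rw [zero_mul, add_zero] at h1 h2
    exact ⟨h1.trans (hlog T K _ hT hK.le), h2⟩
  -- The decrease now has order `p * (3 / 2) + b / 2`, so balance means `p + b = 1`; equating with
  -- `1 + b` gives `b = 1 / 4`.
  · obtain ⟨K, hK, h⟩ := MinimaxLMO.exists_rate_of_stronglyConvexSet (Lxx := Lxx) (Lyx := Lyx)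
      (Lyy := Lyy) (μ := μ) (DX := DX) (DY := DY) (C := C) (s := C) (p := 3 / 4) (a := 1 / 4)
      (b := 1 / 4) hα hC.le hC
      (fun hμ t => le_add_of_nonneg_left hμ) (by norm_num) (by norm_num) (by norm_num)
      (by norm_num) (by norm_num) (by norm_num) (by norm_num) (Or.inr (by norm_num))
    refine ⟨K * (1 + C), by positivity, fun m n X Y L x y hS hc hY ha T hT => ?_⟩
    obtain ⟨h1, h2⟩ := h m n X Y L x y hS hc hY ha T hT
    have h3 := mul_le_mul_of_nonneg_left (hpow T (3 / 4) (1 / 4) hT (by norm_num)) hK.le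
    constructor <;> linarith
  · obtain ⟨K, hK, h⟩ := MinimaxLMO.exists_rate_of_stronglyConvexSet (Lxx := Lxx) (Lyx := Lyx)
      (Lyy := Lyy) (μ := μ) (DX := DX) (DY := DY) (C := 0) (s := μ) (p := 1) (a := 1 / 2)
      (b := 0) hα le_rfl hμ
      (fun _ t => by simp [MinimaxLMO.smoothing]) (by norm_num) (by norm_num) (by norm_num)
      (by norm_num) (by norm_num) (by norm_num) (by norm_num) (Or.inl rfl)
    refine ⟨K, hK, fun m n X Y L x y hS hc hY ha T hT => ?_⟩
    rw [← MinimaxLMO.smoothing_zero_zero] at ha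
    obtain ⟨h1, h2⟩ := h m n X Y L x y hS hc hY ha T hT
    rw [zero_mul, add_zero] at h1 h2
    exact ⟨h1.trans (hlog T K _ hT hK.le), h2⟩
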